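/- Let $L_2=\langle a,t\mid a^2,\ [a^{t^i},a^{t^j}]\ (i,j\in\mathbb Z)\rangle$ be the lamplighter group. Its elements are lamp stands: a finite set of lit lamps in $\mathbb Z$ together with a position $H(g)\in\mathbb Z$ of the lamplighter; right multiplication by $a$ toggles the lamp at the lamplighter's position and right multiplication by $t$ moves the lamplighter one step to the right. Let $d$ be the word metric for the generating set $\{t,at\}$. Let $m(f)$ and $M(f)$ be the least and greatest lit positions of $f$ ($+\infty$ and $-\infty$ if no lamp is lit), and let $m(f,g)$ and $M(f,g)$ be the least and greatest positions at which the lamps of $f$ and $g$ differ ($+\infty$ and $-\infty$ if there are none). Let $i(z)(x)=d(z,x)-d(z,\mathrm{id})$, let $\overline{L_2}$ be the closure of $i(L_2)$ in the space of real functions on $L_2$ with the topology of uniform convergence on finite sets, and let $\partial_hL_2=\overline{L_2}\setminus i(L_2)$. The group $L_2$ acts on $\overline{L_2}$ by $g\cdot\lim_n i(y_n)=\lim_n i(g y_n)$, that is, $(g\cdot h)(x)=h(g^{-1}x)-h(g^{-1})$. Let $\partial_\infty L_2$ be the set of classes of geodesic rays $\mathbb N\to L_2$, two rays being equivalent if they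 stay at bounded distance, with the action of $L_2$ by left translation, and let $\partial_\infty L_2^{\pm}$ be the set of classes of rays $\gamma$ with $H(\gamma(n))\to\pm\infty$. The Busemann function of a class is $\mathfrak b^{\gamma}=\lim_n i(\gamma(n))$, for any ray $\gamma$ in the class. By means of $[\gamma]\mapsto\mathfrak b^\gamma$ we regard $\partial_\infty L_2^{\pm}$ as subsets of $\partial_hL_2$, with the topology of $\partial_hL_2$. 1. The set $i(L_2)$ is invariant under the action of $L_2$. Each of the following families is contained in $\partial_hL_2$ and is invariant under the action of $L_2$: * $\{\mathfrak b^\gamma : [\gamma]\in\partial_\infty L_2^+\}$; * $\{\mathfrak b^\gamma : [\gamma]\in\partial_\infty L_2^-\}$; * the spine $\{\mathfrak s^l : l\in\mathbb Z\}$, where $\mathfrak s^l(g)=|l|-|l-H(g)|$; * the positive ribs $\{\mathfrak r^{+,f} : f\in L_2,\ M(f)<H(f)\}$, where, with $l=H(f)$, $\mathfrak r^{+,f}(g)=2(\min\{m(f),l,0\}-\min\{m(f,g),H(g),l\})+\mathfrak s^l(g)$; * the negative ribs $\{\mathfrak r^{-,f} : f\in L_2,\ m(f)\ge H(f)\}$,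 where, with $l=H(f)$, $\mathfrak r^{-,f}(g)=2(\max\{M(f,g)+1,H(g),l\}-\max\{M(f)+1,l,0\})+\mathfrak s^l(g)$; * $\{H\}$; * $\{-H\}$. 2. Let $g\in L_2$ with $H(g)\ne0$. Then $g$ has exactly two fixed points $g^{\infty}$ and $g^{-\infty}$ on $\partial_\infty L_2$, named so that $g^\infty\in\partial_\infty L_2^+$ and $g^{-\infty}\in\partial_\infty L_2^-$ if $H(g)>0$, and the reverse if $H(g)<0$. The fixed points of $g$ on $\partial_hL_2$ are exactly the four distinct points $H$, $-H$, $\mathfrak b^{g^\infty}$ and $\mathfrak b^{g^{-\infty}}$. 3. Let $g\in L_2$ with $H(g)\ne0$. Then $g$ acts with north–south dynamics on $\partial_\infty L_2^+\cup\{H\}$ and on $\partial_\infty L_2^-\cup\{-H\}$. If $H(g)>0$, the attractor and the repeller are $\mathfrak b^{g^\infty}$ and $H$ on the first set, and $-H$ and $\mathfrak b^{g^{-\infty}}$ on the second set. If $H(g)<0$, they are $H$ and $\mathfrak b^{g^{-\infty}}$ on the first set, and $\mathfrak b^{g^\infty}$ and $-H$ on the second set. Here $g$ acts on $X$ with north–south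 dynamics, with attractor $p$ and repeller $r$, if $gX=X$, $p\neq r$ are points of $X$ fixed by $g$, and for all neighbourhoods $U$ of $p$ and $V$ of $r$ in $X$ one has $g^n(X\setminus V)\subseteq U$ and $g^{-n}(X\setminus U)\subseteq V$ for all sufficiently large $n$. -/

import Mathlib

open Filter Topology
open scoped Pointwise symmDiff

/-- Elements of the lamplighter group `L_2 = ⟨a, t ∣ a ^ 2, [a ^ (t ^ i), a ^ (t ^ j)]⟩ = (ℤ/2) ≀ ℤ`, written as
lamp stands: the finite set of positions of the lit lamps, and the position of the lamplighter. -/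
@[ext] structure LampGroup where
  /-- the positions of the lit lamps -/
  lamps : Finset ℤ
  /-- the position of the lamplighter; this is the height function `H` -/
  height : ℤ

namespace LampGroup

/-- `g * h`: start with the lamp stand of `g`, then move and toggle as in `h`, starting from
position `H(g)`. -/
instance : Mul LampGroup := ⟨fun g h => ⟨g.lamps ∆ (g.height +ᵥ h.lamps), g.height + h.height⟩⟩
instance : One LampGroup := ⟨⟨∅, 0⟩⟩
instance : Inv LampGroup := ⟨fun g => ⟨(-g.height) +ᵥ g.lamps, -g.height⟩⟩

@[simp] theorem mul_lamps (g h : LampGroup) :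
    (g * h).lamps = g.lamps ∆ (g.height +ᵥ h.lamps) := rfl
@[simp] theorem mul_height (g h : LampGroup) : (g * h).height = g.height + h.height := rfl
@[simp] theorem one_lamps : (1 : LampGroup).lamps = ∅ := rfl
@[simp] theorem one_height : (1 : LampGroup).height = 0 := rfl
@[simp] theorem inv_lamps (g : LampGroup) : g⁻¹.lamps = (-g.height) +ᵥ g.lamps := rfl
@[simp] theorem inv_height (g : LampGroup) : g⁻¹.height = -g.height := rfl

instance : Group LampGroup :=
  Group.ofLeftAxioms
    (by
      intro f g h
      ext1
      · simp only [mul_lamps, mul_height, Finset.vadd_finset_symmDiff, add_vadd, symmDiff_assoc]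
      · simp [add_assoc])
    (by
      intro g
      ext1
      · simp only [mul_lamps, one_lamps, one_height, zero_vadd]
        exact bot_symmDiff _
      · simp)
    (by
      intro g
      ext1
      · simp only [mul_lamps, inv_lamps, inv_height, one_lamps, symmDiff_self]
        rfl
      · simp)

/-- The generator `a`: toggle the lamp at the position of the lamplighter. -/
def toggle : LampGroup := ⟨{0}, 0⟩

/-- The generator `t`: the lamplighter steps to the right. -/
def step : LampGroup := ⟨∅, 1⟩

/-- The generating set `S = {t, at}`, whose Cayley graph is the Diestel-Leader graph `DL(2,2)`. -/
def gens : Set LampGroup := {step, toggle * step}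

theorem step_zpow (k : ℤ) : step ^ k = ⟨∅, k⟩ := by
  have hn : ∀ n : ℕ, step ^ n = (⟨∅, n⟩ : LampGroup) := by
    intro n
    induction n with
    | zero => rfl
    | succ n ih =>
      rw [pow_succ, ih]
      ext1
      · simp [step]
      · simp [step]
  obtain ⟨n, rfl | rfl⟩ := k.eq_nat_or_neg
  · rw [zpow_natCast, hn]
  · rw [zpow_neg, zpow_natCast, hn]
    ext1 <;> simp

theorem closure_gens : Subgroup.closure gens = ⊤ := by
  rw [eq_top_iff]
  rintro g -
  have ht : step ∈ Subgroup.closure gens := Subgroup.subset_closure (by simp [gens])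
  have hat : toggle * step ∈ Subgroup.closure gens := Subgroup.subset_closure (by simp [gens])
  have ha : toggle ∈ Subgroup.closure gens := by
    simpa using mul_mem hat (inv_mem ht)
  have hlamp : ∀ s : Finset ℤ, (⟨s, 0⟩ : LampGroup) ∈ Subgroup.closure gens := by
    intro s
    induction s using Finset.induction_on with
    | empty => exact one_mem _
    | insert k s hk ih =>
      have h : (⟨insert k s, 0⟩ : LampGroup) = step ^ k * toggle * (step ^ k)⁻¹ * ⟨s, 0⟩ := by
        rw [step_zpow]
        ext1
        · ext j
          simp only [toggle, mul_lamps, mul_height, inv_lamps, inv_height, Finset.mem_symmDiff,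
            Finset.mem_insert]
          by_cases hj : j = k
          · subst hj; simp [hk]
          · simp [hj]
        · simp [toggle]
      rw [h]
      exact mul_mem (mul_mem (mul_mem (zpow_mem ht k) ha) (inv_mem (zpow_mem ht k))) ih
  have h : g = ⟨g.lamps, 0⟩ * step ^ g.height := by
    rw [step_zpow]
    ext1
    · simp only [mul_lamps, zero_vadd]
      exact (symmDiff_bot _).symm
    · simp
  rw [h]
  exact mul_mem (hlamp _) (zpow_mem ht _)

/-- The lengths of the words in `S ∪ S⁻¹` that represent `g`. -/
def wordLengths (g : LampGroup) : Set ℕ :=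
  {n | ∃ w : List LampGroup, w.length = n ∧ (∀ x ∈ w, x ∈ gens ∨ x⁻¹ ∈ gens) ∧ w.prod = g}

theorem wordLengths_nonempty (g : LampGroup) : (wordLengths g).Nonempty := by
  have hg : g ∈ Subgroup.closure gens := by rw [closure_gens]; trivial
  rw [← Subgroup.mem_toSubmonoid, Subgroup.closure_toSubmonoid] at hg
  obtain ⟨w, hw, hp⟩ := Submonoid.exists_list_of_mem_closure hg
  exact ⟨w.length, w, rfl, hw, hp⟩

/-- The word length with respect to `S`. -/
noncomputable def wordLength (g : LampGroup) : ℕ := sInf (wordLengths g)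

/-- The word metric with respect to `S` (the Diestel-Leader metric). -/
noncomputable def wdist (g h : LampGroup) : ℕ := wordLength (g⁻¹ * h)

theorem wordLength_one : wordLength 1 = 0 :=
  Nat.sInf_eq_zero.2 (Or.inl ⟨[], rfl, by simp, rfl⟩)

theorem wordLength_mul_le (g h : LampGroup) :
    wordLength (g * h) ≤ wordLength g + wordLength h := by
  obtain ⟨v, hv, hv', hvp⟩ := Nat.sInf_mem (wordLengths_nonempty g)
  obtain ⟨w, hw, hw', hwp⟩ := Nat.sInf_mem (wordLengths_nonempty h)
  refine Nat.sInf_le ⟨v ++ w, ?_, ?_, ?_⟩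
  · rw [List.length_append, hv, hw]; rfl
  · intro x hx
    exact (List.mem_append.1 hx).elim (hv' x) (hw' x)
  · rw [List.prod_append, hvp, hwp]

theorem wordLength_inv_le (g : LampGroup) : wordLength g⁻¹ ≤ wordLength g := by
  obtain ⟨v, hv, hv', hvp⟩ := Nat.sInf_mem (wordLengths_nonempty g)
  refine Nat.sInf_le ⟨(v.map (·⁻¹)).reverse, ?_, ?_, ?_⟩
  · rw [List.length_reverse, List.length_map, hv]; rfl
  · intro x hx
    obtain ⟨y, hy, rfl⟩ := List.mem_map.1 (List.mem_reverse.1 hx)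
    rw [inv_inv]
    exact (hv' y hy).symm
  · rw [← List.prod_inv_reverse, hvp]

theorem wdist_self (g : LampGroup) : wdist g g = 0 := by
  rw [wdist, inv_mul_cancel, wordLength_one]

theorem wdist_comm (g h : LampGroup) : wdist g h = wdist h g := by
  have key : ∀ x y : LampGroup, wdist x y ≤ wdist y x := fun x y => by
    have := wordLength_inv_le (y⁻¹ * x)
    rwa [mul_inv_rev, inv_inv] at this
  exact le_antisymm (key g h) (key h g)

theorem wdist_triangle (f g h : LampGroup) : wdist f h ≤ wdist f g + wdist g h := by
  have := wordLength_mul_le (f⁻¹ * g) (g⁻¹ * h)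
  rwa [mul_assoc, mul_inv_cancel_left] at this

theorem wdist_mul_left (k g h : LampGroup) : wdist (k * g) (k * h) = wdist g h := by
  simp [wdist, mul_assoc]

/-! ### The horofunction compactification -/

/-- The embedding `z ↦ d(z, ·) - d(z, id)`. The space of continuous functions on the discrete
space `L_2`, with uniform convergence on compact (that is, finite) sets, is the space of all
functions with the product topology. -/
noncomputable def horoEmb (z : LampGroup) : LampGroup → ℝ :=
  fun x => (wdist z x : ℝ) - (wdist z 1 : ℝ)

/-- The horofunction compactification of `L_2`. -/
def horoCompactification : Set (LampGroup → ℝ) := closure (Set.range horoEmb)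

/-- The horofunction boundary `∂_h L_2`. -/
def horoBoundary : Set (LampGroup → ℝ) := horoCompactification \ Set.range horoEmb

/-- The action of `L_2` on horofunctions, extending left multiplication: it sends the limit of
`horoEmb (y n)` to the limit of `horoEmb (g * y n)`, see `tendsto_act`. -/
def act (g : LampGroup) (h : LampGroup → ℝ) : LampGroup → ℝ :=
  fun x => h (g⁻¹ * x) - h g⁻¹

theorem act_horoEmb (g z : LampGroup) : act g (horoEmb z) = horoEmb (g * z) := by
  have hd : ∀ x, wdist (g * z) x = wdist z (g⁻¹ * x) := fun x => by
    rw [← wdist_mul_left g z, mul_inv_cancel_left]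
  ext x
  simp only [act, horoEmb, hd, mul_one]
  ring

theorem continuous_act (g : LampGroup) : Continuous (act g) :=
  continuous_pi fun _ => (continuous_apply _).sub (continuous_apply _)

theorem tendsto_act (g : LampGroup) {y : ℕ → LampGroup} {h : LampGroup → ℝ}
    (hy : Tendsto (fun n => horoEmb (y n)) atTop (𝓝 h)) :
    Tendsto (fun n => horoEmb (g * y n)) atTop (𝓝 (act g h)) := by
  simpa only [Function.comp_def, act_horoEmb] using ((continuous_act g).tendsto h).comp hy

theorem act_mul (g k : LampGroup) (h : LampGroup → ℝ) : act (g * k) h = act g (act k h) := by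
  ext x
  simp [act, mul_assoc]

theorem act_one {h : LampGroup → ℝ} (hh : h ∈ horoCompactification) : act 1 h = h := by
  have hc : IsClosed {h : LampGroup → ℝ | act 1 h = h} := isClosed_eq (continuous_act 1) continuous_id
  refine closure_minimal ?_ hc hh
  rintro _ ⟨z, rfl⟩
  simp [act_horoEmb]

theorem act_mem_horoCompactification (g : LampGroup) {h : LampGroup → ℝ}
    (hh : h ∈ horoCompactification) : act g h ∈ horoCompactification := by
  refine map_mem_closure (continuous_act g) hh ?_
  rintro _ ⟨z, rfl⟩
  exact ⟨g * z, (act_horoEmb g z).symm⟩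

theorem act_mem_horoBoundary (g : LampGroup) {h : LampGroup → ℝ}
    (hh : h ∈ horoBoundary) : act g h ∈ horoBoundary := by
  refine ⟨act_mem_horoCompactification g hh.1, ?_⟩
  rintro ⟨z, hz⟩
  refine hh.2 ⟨g⁻¹ * z, ?_⟩
  rw [← act_horoEmb, hz, ← act_mul, inv_mul_cancel, act_one hh.1]

/-! ### The visual boundary and Busemann functions -/

/-- Geodesic rays: isometric embeddings of `ℕ` into `L_2`. -/
structure Ray where
  /-- the point at time `n` -/
  pt : ℕ → LampGroup
  isometric : ∀ m n : ℕ, m ≤ n → wdist (pt m) (pt n) = n - m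

/-- Two rays are asymptotic if they stay at bounded distance. -/
def Ray.Asymptotic (γ δ : Ray) : Prop := ∃ K : ℕ, ∀ n, wdist (γ.pt n) (δ.pt n) ≤ K

instance raySetoid : Setoid Ray where
  r := Ray.Asymptotic
  iseqv :=
    { refl := fun _ => ⟨0, fun _ => (wdist_self _).le⟩
      symm := fun ⟨K, hK⟩ => ⟨K, fun n => (wdist_comm _ _).le.trans (hK n)⟩
      trans := fun ⟨K, hK⟩ ⟨L, hL⟩ =>
        ⟨K + L, fun n => (wdist_triangle _ _ _).trans (add_le_add (hK n) (hL n))⟩ }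

/-- The visual boundary `∂_∞ L_2`: asymptotic classes of geodesic rays. -/
def VisualBoundary : Type := Quotient raySetoid

/-- The translate of a ray by a group element. -/
def Ray.translate (g : LampGroup) (γ : Ray) : Ray where
  pt n := g * γ.pt n
  isometric m n h := by rw [wdist_mul_left, γ.isometric m n h]

/-- The point of the visual boundary represented by a ray. -/
def Ray.endpoint (γ : Ray) : VisualBoundary := Quotient.mk raySetoid γ

/-- The action of `L_2` on its visual boundary. -/
def visualAct (g : LampGroup) : VisualBoundary → VisualBoundary :=
  Quotient.map (Ray.translate g) fun _ _ ⟨K, hK⟩ =>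
    ⟨K, fun n => (wdist_mul_left g _ _).le.trans (hK n)⟩

/-- The upper visual boundary `∂_∞ L_2^+`: the lamplighter goes to `+∞`. -/
def visualPlus : Set VisualBoundary :=
  {ξ | ∃ γ : Ray, γ.endpoint = ξ ∧ Tendsto (fun n => (γ.pt n).height) atTop atTop}

/-- The lower visual boundary `∂_∞ L_2^-`: the lamplighter goes to `-∞`. -/
def visualMinus : Set VisualBoundary :=
  {ξ | ∃ γ : Ray, γ.endpoint = ξ ∧ Tendsto (fun n => (γ.pt n).height) atTop atBot}

/-- `b` is the Busemann function of the boundary point `ξ`: along every ray `γ` representing `ξ`,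
`d(γ n, x) - d(γ n, id)` converges to `b x` for all `x`. -/
def IsBusemann (ξ : VisualBoundary) (b : LampGroup → ℝ) : Prop :=
  ∀ γ : Ray, γ.endpoint = ξ → Tendsto (fun n => horoEmb (γ.pt n)) atTop (𝓝 b)

/-! ### The families of horofunctions -/

/-- The image of `∂_∞ L_2^+` in the space of horofunctions. -/
def busemannPlus : Set (LampGroup → ℝ) := {b | ∃ ξ ∈ visualPlus, IsBusemann ξ b}

/-- The image of `∂_∞ L_2^-` in the space of horofunctions. -/
def busemannMinus : Set (LampGroup → ℝ) := {b | ∃ ξ ∈ visualMinus, IsBusemann ξ b}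

/-- The height function `H` as a real-valued function. -/
def heightFun : LampGroup → ℝ := fun g => (g.height : ℝ)

/-- `m(f)`, the least lit position, or `⊤` if no lamp is lit. -/
def minLamp (f : LampGroup) : WithTop ℤ := f.lamps.min

/-- `M(f)`, the greatest lit position, or `⊥` if no lamp is lit. -/
def maxLamp (f : LampGroup) : WithBot ℤ := f.lamps.max

/-- `m(f, g)`, the least position where the lamps of `f` and `g` differ, or `⊤`. -/
def minDiff (f g : LampGroup) : WithTop ℤ := (f.lamps ∆ g.lamps).min

/-- `M(f, g)`, the greatest position where the lamps of `f` and `g` differ, or `⊥`. -/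
def maxDiff (f g : LampGroup) : WithBot ℤ := (f.lamps ∆ g.lamps).max

/-- The minimum of an extended integer and two integers; it is finite. -/
def minThree (x : WithTop ℤ) (i j : ℤ) : ℤ := (min x ((min i j : ℤ) : WithTop ℤ)).untopD 0

/-- The maximum of an extended integer and two integers; it is finite. -/
def maxThree (x : WithBot ℤ) (i j : ℤ) : ℤ := (max x ((max i j : ℤ) : WithBot ℤ)).unbotD 0

/-- The spine horofunction at height `l`: `|l| - |l - H(g)|`. -/
def spineFun (l : ℤ) : LampGroup → ℝ := fun g => ((|l| - |l - g.height| : ℤ) : ℝ)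

/-- The positive rib horofunction of `f`, meant for `M(f) < H(f) = l`:
`2 (min {m(f), l, 0} - min {m(f, g), H(g), l}) + |l| - |l - H(g)|`. -/
def ribPlusFun (f : LampGroup) : LampGroup → ℝ := fun g =>
  ((2 * (minThree (minLamp f) f.height 0 - minThree (minDiff f g) g.height f.height) : ℤ) : ℝ)
    + spineFun f.height g

/-- The negative rib horofunction of `f`, meant for `m(f) ≥ H(f) = l`:
`2 (max {M(f, g) + 1, H(g), l} - max {M(f) + 1, l, 0}) + |l| - |l - H(g)|`. -/
def ribMinusFun (f : LampGroup) : LampGroup → ℝ := fun g =>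
  ((2 * (maxThree (maxDiff f g + 1) g.height f.height
      - maxThree (maxLamp f + 1) f.height 0) : ℤ) : ℝ)
    + spineFun f.height g

/-- The spine. -/
def spine : Set (LampGroup → ℝ) := Set.range spineFun

/-- The positive ribs. -/
def ribsPlus : Set (LampGroup → ℝ) :=
  {h | ∃ f : LampGroup, maxLamp f < (f.height : WithBot ℤ) ∧ h = ribPlusFun f}

/-- The negative ribs. -/
def ribsMinus : Set (LampGroup → ℝ) :=
  {h | ∃ f : LampGroup, (f.height : WithTop ℤ) ≤ minLamp f ∧ h = ribMinusFun f}

/-- The families into which the horofunction boundary is classified. -/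
def boundaryFamilies : Set (Set (LampGroup → ℝ)) :=
  {busemannPlus, busemannMinus, spine, ribsPlus, ribsMinus, {heightFun}, {-heightFun}}

/-- `g` acts on the set `X` of horofunctions (with the subspace topology) with north-south dynamics,
with attractor `p` and repeller `r`. -/
structure NorthSouthOn (g : LampGroup) (X : Set (LampGroup → ℝ)) (p r : LampGroup → ℝ) : Prop where
  invariant : act g '' X = X
  attractor_mem : p ∈ X
  repeller_mem : r ∈ X
  poles_ne : p ≠ r
  attractor_fixed : act g p = p
  repeller_fixed : act g r = r
  attracts : ∀ U ∈ 𝓝[X] p, ∀ V ∈ 𝓝[X] r, ∀ᶠ n : ℕ in atTop,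
    ∀ h ∈ X \ V, act (g ^ n) h ∈ U
  repels : ∀ U ∈ 𝓝[X] p, ∀ V ∈ 𝓝[X] r, ∀ᶠ n : ℕ in atTop,
    ∀ h ∈ X \ U, act (g⁻¹ ^ n) h ∈ V

end LampGroup

open LampGroup

/-! Lamp `k` can be toggled only while the lamplighter crosses the edge from `k` to `k + 1`. A
shortest tour from `z` to `x` therefore sweeps an interval containing both heights and all edges
whose lamps differ, and its length is twice the length of that interval minus the height difference
(`wordLength_eq`, `wdist_eq`). Hence `horoEmb z x` splits into a term for the lower end of the tour,
a mirror term for the upper end, and a spine term depending on heights only (`horoEmb_eq`). The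
automorphism `reflect` exchanges the two ends, so each statement is needed for one end only.

Along an ultrafilter, the lower end either escapes to `-∞` and contributes `0`, or the lamps
converge to a set `ω` bounded below and the contribution converges. The upper end behaves likewise,
and the height is eventually constant or tends to `±∞`. The possible combinations give the seven
families (`horoBoundary_classification`); if neither end escapes, the limit is an interior point.
Every family consists of functions unbounded below, which no interior point is.

A geodesic ray with heights unbounded above eventually climbs at every step (`Ray.eventually_up`),
freezing the lamps behind it. The upper visual boundary is thereby identified with the sets `ω`
bounded below, with Busemann functions `busemann ω`, and `g` acts by `move g`: translate by the
height of `g`, then take the symmetric difference with the lamps of `g`. A fixed configuration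
solves a recursion with step the height of `g`; boundedness below makes the solution exist and be
unique (`exists_unique_fixed`). Spine and rib points remember a finite height, which `g` shifts, so
none is fixed, while `H` and `-H` always are.

For the dynamics, `busemann ω` is near `busemann ω₀` when `ω` and `ω₀` agree far up, and near `H`
when `ω` has a lamp lit far down. If `ω₀` is fixed by `g`, the set where `ω` and `ω₀` differ is
merely translated by `g` (`mem_move_iff_of_fixed`), so powers of `g` push every disagreement to
infinity. Inversion and reflection give the remaining cases. -/

namespace LampGroup

/-! ### Least elements of sets of integers -/

/-- The least element of `insert i D`. -/
noncomputable def lo (D : Set ℤ) (i : ℤ) : ℤ := sInf (insert i D)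

theorem le_lo_iff {D : Set ℤ} (hD : BddBelow D) {i c : ℤ} :
    c ≤ lo D i ↔ c ≤ i ∧ ∀ k ∈ D, c ≤ k := by
  rw [lo, le_csInf_iff (hD.insert i) (Set.insert_nonempty _ _)]
  simp

theorem lo_le {D : Set ℤ} (hD : BddBelow D) (i : ℤ) : lo D i ≤ i :=
  ((le_lo_iff hD).1 le_rfl).1

theorem lo_le_of_mem {D : Set ℤ} (hD : BddBelow D) {i k : ℤ} (hk : k ∈ D) : lo D i ≤ k :=
  ((le_lo_iff hD).1 le_rfl).2 k hk

theorem lo_eq_of_le_iff {D E : Set ℤ} (hD : BddBelow D) (hE : BddBelow E) {i j : ℤ}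
    (h : ∀ c, (c ≤ i ∧ ∀ k ∈ D, c ≤ k) ↔ (c ≤ j ∧ ∀ k ∈ E, c ≤ k)) : lo D i = lo E j :=
  eq_of_forall_le_iff fun c => by rw [le_lo_iff hD, le_lo_iff hE, h]

theorem lo_eq_self {D : Set ℤ} {i : ℤ} (h : ∀ k ∈ D, i ≤ k) : lo D i = i :=
  have hD : BddBelow D := ⟨i, h⟩
  le_antisymm (lo_le hD i) ((le_lo_iff hD).2 ⟨le_rfl, h⟩)

theorem lo_translate {D E : Set ℤ} (hD : BddBelow D) {a i j : ℤ} (hj : j = a + i)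
    (h : ∀ k, k ∈ E ↔ k - a ∈ D) : lo E j = a + lo D i := by
  have hE : BddBelow E := by
    obtain ⟨c, hc⟩ := hD
    exact ⟨c + a, fun k hk => by have := hc ((h k).1 hk); omega⟩
  refine eq_of_forall_le_iff fun c => ?_
  have : c ≤ a + lo D i ↔ c - a ≤ lo D i := by omega
  rw [this, le_lo_iff hE, le_lo_iff hD]
  refine and_congr (by omega) ⟨fun H k hk => ?_, fun H k hk => ?_⟩
  · have := H (k + a) ((h _).2 (by simpa using hk)); omega
  · have := H _ ((h k).1 hk); omega

theorem bddBelow_symmDiff {D E : Set ℤ} (hD : BddBelow D) (hE : BddBelow E) :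
    BddBelow (D ∆ E) :=
  (hD.union hE).mono symmDiff_le_sup

theorem bddBelow_lamps (f : LampGroup) : BddBelow (f.lamps : Set ℤ) := f.lamps.bddBelow

theorem bddBelow_diff (f g : LampGroup) : BddBelow ((f.lamps : Set ℤ) ∆ g.lamps) :=
  bddBelow_symmDiff (bddBelow_lamps f) (bddBelow_lamps g)

theorem mem_vadd_finset_int {a j : ℤ} {s : Finset ℤ} : j ∈ a +ᵥ s ↔ j - a ∈ s := by
  rw [Finset.mem_vadd_finset]
  constructor
  · rintro ⟨y, hy, rfl⟩
    simpa using hy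
  · intro h
    exact ⟨_, h, by simp⟩

/-! ### The reflection -/

/-- The automorphism of the lamplighter group that reverses the direction of the integers; lamp `k`,
which sits between the positions `k` and `k + 1`, goes to lamp `-1 - k`. -/
def reflect (f : LampGroup) : LampGroup := ⟨f.lamps.image (fun k => -1 - k), -f.height⟩

@[simp] theorem mem_reflect_lamps {f : LampGroup} {k : ℤ} :
    k ∈ (reflect f).lamps ↔ -1 - k ∈ f.lamps := by
  simp only [reflect, Finset.mem_image]
  constructor
  · rintro ⟨y, hy, rfl⟩
    simpa using hy
  · intro h
    exact ⟨_, h, by simp⟩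

@[simp] theorem reflect_height (f : LampGroup) : (reflect f).height = -f.height := rfl

@[simp] theorem reflect_reflect (f : LampGroup) : reflect (reflect f) = f := by
  ext <;> simp

theorem reflect_mul (f g : LampGroup) : reflect (f * g) = reflect f * reflect g := by
  ext k
  · simp only [mem_reflect_lamps, mul_lamps, Finset.mem_symmDiff, mem_vadd_finset_int,
      reflect_height]
    rw [show -1 - (k - -f.height) = -1 - k - f.height by ring]
  · simp [add_comm]

@[simp] theorem reflect_one : reflect 1 = 1 := by
  ext <;> simp

theorem reflect_inv (f : LampGroup) : reflect f⁻¹ = (reflect f)⁻¹ :=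
  eq_inv_of_mul_eq_one_left (by rw [← reflect_mul, inv_mul_cancel, reflect_one])

theorem reflect_pow (f : LampGroup) (n : ℕ) : reflect (f ^ n) = reflect f ^ n := by
  induction n with
  | zero => simp
  | succ n ih => rw [pow_succ, pow_succ, reflect_mul, ih]

/-! ### The word metric -/

/-- The length of a shortest tour, as an explicit expression; see `wordLength_eq`. -/
noncomputable def tourLength (g : LampGroup) : ℤ :=
  -2 * (lo g.lamps (min g.height 0) + lo (reflect g).lamps (min (-g.height) 0)) - |g.height|

theorem tourLength_reflect (g : LampGroup) : tourLength (reflect g) = tourLength g := by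
  simp only [tourLength, reflect_height, reflect_reflect, neg_neg, abs_neg]
  ring

theorem le_low_iff {g : LampGroup} {c : ℤ} : c ≤ lo g.lamps (min g.height 0) ↔
    c ≤ g.height ∧ c ≤ 0 ∧ ∀ k ∈ g.lamps, c ≤ k := by
  rw [le_lo_iff (bddBelow_lamps g), le_min_iff, and_assoc]; rfl

theorem le_high_iff {g : LampGroup} {c : ℤ} : c ≤ lo (reflect g).lamps (min (-g.height) 0) ↔
    c ≤ -g.height ∧ c ≤ 0 ∧ ∀ k ∈ g.lamps, c ≤ -1 - k := by
  rw [le_lo_iff (bddBelow_lamps _), le_min_iff, and_assoc]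
  refine and_congr_right fun _ => and_congr_right fun _ => ⟨fun h k hk => h _ ?_, fun h k hk => ?_⟩
  · simpa using hk
  · have := h _ (mem_reflect_lamps.1 hk); omega

theorem mem_mul_step {g : LampGroup} {k : ℤ} : k ∈ (g * step).lamps ↔ k ∈ g.lamps := by
  simp [step, Finset.mem_symmDiff]

theorem mem_mul_toggle_step {g : LampGroup} {k : ℤ} :
    k ∈ (g * (toggle * step)).lamps ↔ (k ∈ g.lamps ↔ k ≠ g.height) := by
  simp only [mul_lamps, toggle, step, Finset.mem_symmDiff, mem_vadd_finset_int]
  simp [sub_eq_zero]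
  tauto

theorem height_mul_of_mem_gens {g s : LampGroup} (hs : s ∈ gens) :
    (g * s).height = g.height + 1 := by
  rcases hs with rfl | rfl <;> simp [step, toggle]

theorem mem_mul_of_mem_gens {g s : LampGroup} (hs : s ∈ gens) {k : ℤ} (hk : k ≠ g.height) :
    k ∈ (g * s).lamps ↔ k ∈ g.lamps := by
  rcases hs with rfl | rfl
  · exact mem_mul_step
  · rw [mem_mul_toggle_step]; tauto

theorem exists_gen_toggle_off (g : LampGroup) : ∃ s ∈ gens, g.height ∉ (g * s).lamps := by
  by_cases h : g.height ∈ g.lamps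
  · exact ⟨_, Or.inr rfl, by rw [mem_mul_toggle_step]; tauto⟩
  · exact ⟨_, Or.inl rfl, by rwa [mem_mul_step]⟩

theorem reflect_mem_gens {s : LampGroup} (hs : s ∈ gens) : (reflect s)⁻¹ ∈ gens := by
  rcases hs with rfl | rfl
  · left
    ext <;> simp [step, mem_vadd_finset_int]
  · right
    ext k
    · simp only [step, toggle, mul_lamps, inv_lamps, mem_vadd_finset_int, Finset.mem_symmDiff,
        mem_reflect_lamps]
      simp
      omega
    · simp [step, toggle]

/-- A generator moves the lamplighter one step up and affects only the lamp on the crossed edge. The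
lower end cannot drop, and the upper end rises to at most the new height. -/
theorem tourLength_mul_gen_le {g s : LampGroup} (hs : s ∈ gens) :
    tourLength (g * s) ≤ tourLength g + 1 := by
  have hh := height_mul_of_mem_gens (g := g) hs
  have hm := fun k => mem_mul_of_mem_gens (g := g) hs (k := k)
  set g' := g * s
  simp only [tourLength]
  obtain ⟨a1, a2, a3⟩ := le_low_iff.1 (le_refl (lo g.lamps (min g.height 0)))
  obtain ⟨b1, b2, b3⟩ := le_high_iff.1 (le_refl (lo (reflect g).lamps (min (-g.height) 0)))
  set a := lo g.lamps (min g.height 0)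
  set b := lo (reflect g).lamps (min (-g.height) 0)
  have ha : a ≤ lo g'.lamps (min g'.height 0) := by
    refine le_low_iff.2 ⟨by omega, a2, fun k hk => ?_⟩
    by_cases h : k = g.height
    · omega
    · exact a3 k ((hm k h).1 hk)
  have hb : min b (-g.height - 1) ≤ lo (reflect g').lamps (min (-g'.height) 0) := by
    refine le_high_iff.2 ⟨by omega, by omega, fun k hk => ?_⟩
    by_cases h : k = g.height
    · omega
    · have := b3 k ((hm k h).1 hk); omega
  rw [hh]
  rw [hh] at ha hb
  -- If the upper end rises, it was equal to the height, which is then nonnegative; the growth of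
  -- `|height|` absorbs one of the two extra units.
  grind

theorem tourLength_mul_gen_inv_le {g s : LampGroup} (hs : s⁻¹ ∈ gens) :
    tourLength (g * s) ≤ tourLength g + 1 := by
  have := tourLength_mul_gen_le (g := reflect g) (reflect_mem_gens hs)
  rwa [reflect_inv, inv_inv, ← reflect_mul, tourLength_reflect, tourLength_reflect] at this

theorem tourLength_one : tourLength 1 = 0 := by
  simp [tourLength, lo]

theorem tourLength_le_wordLength (g : LampGroup) : tourLength g ≤ wordLength g := by
  obtain ⟨w, hw, hw', rfl⟩ := Nat.sInf_mem (wordLengths_nonempty g)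
  rw [wordLength, ← hw]
  clear hw
  induction w using List.reverseRecOn with
  | nil => simp [tourLength_one]
  | append_singleton w s ih =>
    have h1 := ih fun x hx => hw' x (by simp [hx])
    have h2 : tourLength (w.prod * s) ≤ tourLength w.prod + 1 :=
      (hw' s (by simp)).elim tourLength_mul_gen_le tourLength_mul_gen_inv_le
    simp only [List.prod_append, List.prod_singleton, List.length_append, List.length_singleton]
    push_cast
    omega

theorem wordLength_reflect_le (g : LampGroup) : wordLength (reflect g) ≤ wordLength g := by
  obtain ⟨w, hw, hw', hp⟩ := Nat.sInf_mem (wordLengths_nonempty g)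
  refine Nat.sInf_le ⟨w.map reflect, by rw [List.length_map, hw]; rfl, ?_, ?_⟩
  · intro x hx
    obtain ⟨y, hy, rfl⟩ := List.mem_map.1 hx
    rcases hw' y hy with h | h
    · exact Or.inr (reflect_mem_gens h)
    · left
      simpa [reflect_inv] using reflect_mem_gens h
  · rw [← hp]
    clear hp hw hw'
    induction w with
    | nil => simp
    | cons s w ih => simp [reflect_mul, ih]

theorem wordLength_reflect (g : LampGroup) : wordLength (reflect g) = wordLength g :=
  le_antisymm (wordLength_reflect_le g) (by simpa using wordLength_reflect_le (reflect g))

theorem wordLength_gen_le {s : LampGroup} (hs : s ∈ gens ∨ s⁻¹ ∈ gens) : wordLength s ≤ 1 :=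
  Nat.sInf_le ⟨[s], rfl, by simpa using hs, by simp⟩

/-- The last step of a shortest tour is undone: move up while there is something above, otherwise
move down, in both cases switching off the lamp on the crossed edge. -/
theorem exists_tourLength_descent {g : LampGroup} (hg : g ≠ 1) (h0 : 0 ≤ g.height) :
    ∃ s, (s ∈ gens ∨ s⁻¹ ∈ gens) ∧ tourLength (g * s) + 1 ≤ tourLength g := by
  obtain ⟨a1, a2, a3⟩ := le_low_iff.1 (le_refl (lo g.lamps (min g.height 0)))
  obtain ⟨b1, b2, b3⟩ := le_high_iff.1 (le_refl (lo (reflect g).lamps (min (-g.height) 0)))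
  obtain ⟨b, hb⟩ : ∃ b, b = lo (reflect g).lamps (min (-g.height) 0) := ⟨_, rfl⟩
  obtain ⟨a, ha⟩ : ∃ a, a = lo g.lamps (min g.height 0) := ⟨_, rfl⟩
  simp only [← ha, ← hb] at a1 a2 a3 b1 b2 b3
  have hN : tourLength g = -2 * (a + b) - |g.height| := by rw [tourLength, ← ha, ← hb]
  -- The upper end of the tour is `-b`. If it exceeds the height, a step up keeps both ends and
  -- increases `|height|`.
  by_cases hA : b < -g.height
  · obtain ⟨s, hs, hoff⟩ := exists_gen_toggle_off g
    refine ⟨s, Or.inl hs, ?_⟩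
    have hh := height_mul_of_mem_gens (g := g) hs
    have hm := fun k => mem_mul_of_mem_gens (g := g) hs (k := k)
    have h1 : a ≤ lo (g * s).lamps (min (g * s).height 0) := by
      refine le_low_iff.2 ⟨by omega, a2, fun k hk => ?_⟩
      exact a3 k ((hm k (by rintro rfl; exact hoff hk)).1 hk)
    have h2 : b ≤ lo (reflect (g * s)).lamps (min (-(g * s).height) 0) := by
      refine le_high_iff.2 ⟨by omega, b2, fun k hk => ?_⟩
      exact b3 k ((hm k (by rintro rfl; exact hoff hk)).1 hk)
    rw [hN, tourLength, abs_of_nonneg h0, abs_of_nonneg (a := (g * s).height) (by omega)]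
    omega
  · have hb : b = -g.height := by omega
    have hlamp : ∀ k ∈ g.lamps, k < g.height := fun k hk => by have := b3 k hk; omega
    obtain ⟨s, hs, hoff⟩ := exists_gen_toggle_off (reflect g)
    have hs' := reflect_mem_gens hs
    refine ⟨reflect s, Or.inr hs', ?_⟩
    have hh := height_mul_of_mem_gens (g := reflect g) hs
    have hm := fun k => mem_mul_of_mem_gens (g := reflect g) hs (k := k)
    rw [← reflect_reflect g, ← reflect_mul, reflect_reflect g] at *
    set f := reflect g * s
    have hfm : ∀ k ∈ (reflect f).lamps, k ∈ g.lamps ∧ k ≠ g.height - 1 := by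
      intro k hk
      rw [mem_reflect_lamps] at hk
      have hne : -1 - k ≠ (reflect g).height := by rintro h; rw [h] at hk; exact hoff hk
      refine ⟨by simpa using (hm _ hne).1 hk, ?_⟩
      rintro rfl
      exact hne (by rw [reflect_height]; ring)
    have hfh : (reflect f).height = g.height - 1 := by
      rw [reflect_height, hh, reflect_height]; ring
    generalize reflect f = f' at *
    -- At positive height a step down lowers the upper end by one, gaining `2`, and loses `1`
    -- through `|height|`. At height `0` the upper end stays, and `|height|` grows to `1`.
    rcases h0.lt_or_eq with hpos | hzero
    · have h1 : a ≤ lo f'.lamps (min f'.height 0) :=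
        le_low_iff.2 ⟨by omega, a2, fun k hk => a3 k (hfm k hk).1⟩
      have h2 : b + 1 ≤ lo (reflect f').lamps (min (-f'.height) 0) := by
        refine le_high_iff.2 ⟨by omega, by omega, fun k hk => ?_⟩
        have := hlamp k (hfm k hk).1
        have := (hfm k hk).2
        omega
      rw [hN, tourLength, abs_of_nonneg h0, abs_of_nonneg (a := f'.height) (by omega)]
      omega
    -- With every lit lamp below height `0` and `g ≠ 1`, some lamp is lit at a negative position, so
    -- stepping down to `-1` does not extend the tour.
    · have ha0 : a < 0 := by
        refine lt_of_le_of_ne a2 ?_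
        intro h
        refine hg ?_
        ext k
        · simp only [one_lamps, Finset.notMem_empty, iff_false]
          intro hk
          have := hlamp k hk
          have := a3 k hk
          omega
        · exact hzero.symm
      have h1 : a ≤ lo f'.lamps (min f'.height 0) :=
        le_low_iff.2 ⟨by omega, a2, fun k hk => a3 k (hfm k hk).1⟩
      have h2 : b ≤ lo (reflect f').lamps (min (-f'.height) 0) := by
        refine le_high_iff.2 ⟨by omega, by omega, fun k hk => ?_⟩
        exact b3 k (hfm k hk).1
      rw [hN, tourLength, abs_of_nonneg h0, abs_of_nonpos (a := f'.height) (by omega)]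
      omega

theorem wordLength_le_tourLength (n : ℕ) :
    ∀ g : LampGroup, tourLength g ≤ n → (wordLength g : ℤ) ≤ tourLength g := by
  induction n using Nat.strong_induction_on with
  | _ n ih =>
    have key : ∀ g : LampGroup, 0 ≤ g.height → tourLength g ≤ n →
        (wordLength g : ℤ) ≤ tourLength g := by
      intro g h0 hn
      by_cases hg : g = 1
      · subst hg; simp [wordLength_one, tourLength_one]
      obtain ⟨s, hs, hd⟩ := exists_tourLength_descent hg h0
      have h1 : 0 ≤ tourLength (g * s) := by
        obtain ⟨a1, a2, -⟩ := le_low_iff.1 (le_refl (lo (g * s).lamps (min (g * s).height 0)))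
        obtain ⟨b1, b2, -⟩ :=
          le_high_iff.1 (le_refl (lo (reflect (g * s)).lamps (min (-(g * s).height) 0)))
        rw [tourLength]
        rcases abs_cases (g * s).height with h | h <;> omega
      have h2 := ih (n - 1) (by omega) (g * s) (by omega)
      have h3 := wordLength_mul_le (g * s) s⁻¹
      rw [mul_inv_cancel_right] at h3
      have h4 := wordLength_gen_le (s := s⁻¹) (by rw [inv_inv]; exact hs.symm)
      omega
    intro g hn
    rcases le_total 0 g.height with h0 | h0
    · exact key g h0 hn
    · have := key (reflect g) (by simpa using h0) (by rwa [tourLength_reflect])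
      rwa [wordLength_reflect, tourLength_reflect] at this

theorem wordLength_eq (g : LampGroup) : (wordLength g : ℤ) = tourLength g :=
  le_antisymm (wordLength_le_tourLength _ g (Int.self_le_toNat _)) (tourLength_le_wordLength g)

/-- The least position of a tour from `z` to `x`. -/
noncomputable def tourMin (z x : LampGroup) : ℤ :=
  lo ((z.lamps : Set ℤ) ∆ x.lamps) (min z.height x.height)

theorem lo_inv_mul (z x : LampGroup) :
    lo (z⁻¹ * x).lamps (min (z⁻¹ * x).height 0) = tourMin z x - z.height := by
  have := lo_translate (D := (z⁻¹ * x).lamps) (E := (z.lamps : Set ℤ) ∆ x.lamps)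
    (bddBelow_lamps _) (a := z.height) (i := min (z⁻¹ * x).height 0) (j := min z.height x.height)
    (by simp only [mul_height, inv_height]; omega) (fun k => by
      simp only [Set.mem_symmDiff, Finset.mem_coe, mul_lamps, inv_lamps, inv_height,
        Finset.mem_symmDiff, mem_vadd_finset_int]
      simp)
  rw [tourMin, this]
  ring

theorem wdist_eq (z x : LampGroup) : (wdist z x : ℤ) =
    -2 * (tourMin z x + tourMin (reflect z) (reflect x)) - |z.height - x.height| := by
  have h1 := lo_inv_mul (reflect z) (reflect x)
  rw [← reflect_inv, ← reflect_mul, reflect_height, reflect_height] at h1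
  rw [wdist, wordLength_eq, tourLength, lo_inv_mul, h1, mul_height, inv_height,
    neg_add_eq_sub, abs_sub_comm]
  ring

theorem le_tourMin_iff {z x : LampGroup} {c : ℤ} : c ≤ tourMin z x ↔
    c ≤ z.height ∧ c ≤ x.height ∧ ∀ k, ¬ (k ∈ z.lamps ↔ k ∈ x.lamps) → c ≤ k := by
  rw [tourMin, le_lo_iff (bddBelow_diff z x), le_min_iff, and_assoc]
  simp only [Set.mem_symmDiff, Finset.mem_coe]
  refine and_congr_right fun _ => and_congr_right fun _ => forall_congr' fun k => ?_
  rw [show (k ∈ z.lamps ∧ k ∉ x.lamps ∨ k ∈ x.lamps ∧ k ∉ z.lamps) ↔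
    ¬ (k ∈ z.lamps ↔ k ∈ x.lamps) by tauto]

theorem le_tourMin_reflect_iff {z x : LampGroup} {c : ℤ} :
    c ≤ tourMin (reflect z) (reflect x) ↔
    c ≤ -z.height ∧ c ≤ -x.height ∧ ∀ k, ¬ (k ∈ z.lamps ↔ k ∈ x.lamps) → c ≤ -1 - k := by
  rw [le_tourMin_iff]
  simp only [mem_reflect_lamps, reflect_height]
  refine and_congr_right fun _ => and_congr_right fun _ => ⟨fun h k hk => h _ ?_, fun h k hk => ?_⟩
  · simpa using hk
  · have := h _ hk; omega

theorem wdist_reflect (z x : LampGroup) : wdist (reflect z) (reflect x) = wdist z x := by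
  rw [wdist, wdist, ← reflect_inv, ← reflect_mul, wordLength_reflect]

/-! ### Limits of horofunctions -/

/-- The contribution to `horoEmb z x` of the lower end of the tour from `z` to `x`. -/
noncomputable def lowPart (z x : LampGroup) : ℤ := 2 * (tourMin z 1 - tourMin z x)

/-- The distance formula is a sum over the two ends of the tour and a height term, so each end can
be sent to its limit independently. -/
theorem horoEmb_eq (z x : LampGroup) :
    horoEmb z x = (lowPart z x : ℝ) + (lowPart (reflect z) (reflect x) : ℝ) + spineFun z.height x := by
  have h1 := wdist_eq z x
  have h2 := wdist_eq z 1
  rw [reflect_one, one_height, sub_zero] at h2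
  have : ((wdist z x : ℤ) - (wdist z 1 : ℤ) : ℤ) = lowPart z x + lowPart (reflect z) (reflect x) +
      (|z.height| - |z.height - x.height|) := by
    rw [h1, h2, lowPart, lowPart]
    ring
  simp only [horoEmb, spineFun]
  exact_mod_cast this

/-- Along `F`, the lamplighter or a lit lamp goes to `-∞`. -/
def LowInf (F : Filter LampGroup) : Prop :=
  ∀ c : ℤ, ∀ᶠ z in F, z.height < c ∨ ∃ k ∈ z.lamps, k < c

/-- Along `F`, the lamps converge to those of `ω`, and neither the lamplighter nor a lit lamp escapes
to `-∞`. -/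
def LowTo (F : Filter LampGroup) (ω : Set ℤ) : Prop :=
  (∃ c : ℤ, (∀ k ∈ ω, c ≤ k) ∧ ∀ᶠ z in F, c ≤ z.height ∧ ∀ k ∈ z.lamps, c ≤ k) ∧
    ∀ k : ℤ, ∀ᶠ z in F, k ∈ z.lamps ↔ k ∈ ω

theorem LowTo.bddBelow {F : Filter LampGroup} {ω : Set ℤ} (h : LowTo F ω) : BddBelow ω :=
  let ⟨⟨c, hc, _⟩, _⟩ := h
  ⟨c, hc⟩

theorem exists_lower_bound (x : LampGroup) :
    ∃ c : ℤ, c ≤ 0 ∧ c ≤ x.height ∧ ∀ k ∈ x.lamps, c ≤ k := by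
  obtain ⟨c, hc⟩ := bddBelow_lamps x
  exact ⟨min c (min 0 x.height), by omega, by omega, fun k hk => by
    have : c ≤ k := hc hk
    omega⟩

/-- Once `z` reaches below `0`, the height of `x` and all lamps of `x`, the tours from `z` to `x`
and to `1` have the same lower end, determined by `z` alone. -/
theorem LowInf.lowPart_eq_zero {F : Filter LampGroup} (hF : LowInf F) (x : LampGroup) :
    ∀ᶠ z in F, lowPart z x = 0 := by
  obtain ⟨c, hc0, hch, hcl⟩ := exists_lower_bound x
  filter_upwards [hF c] with z hz
  have : tourMin z 1 = tourMin z x := by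
    refine eq_of_forall_le_iff fun d => ?_
    rw [le_tourMin_iff, le_tourMin_iff]
    simp only [one_height, one_lamps, Finset.notMem_empty, iff_false, not_not]
    constructor
    · rintro ⟨h1, h2, h3⟩
      have hd : d ≤ c := by
        rcases hz with hz | ⟨k, hk, hz⟩
        · omega
        · have := h3 k hk; omega
      refine ⟨h1, by omega, fun k hk => ?_⟩
      by_cases hkx : k ∈ x.lamps
      · have := hcl k hkx; omega
      · exact h3 k (by tauto)
    · rintro ⟨h1, h2, h3⟩
      have hd : d ≤ c := by
        rcases hz with hz | ⟨k, hk, hz⟩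
        · omega
        · have : k ∉ x.lamps := fun h => by have := hcl k h; omega
          have := h3 k (by tauto)
          omega
      refine ⟨h1, by omega, fun k hk => ?_⟩
      by_cases hkx : k ∈ x.lamps
      · have := hcl k hkx; omega
      · exact h3 k (by tauto)
  rw [lowPart, this]
  ring

theorem LowTo.lo_eq {F : Filter LampGroup} {ω : Set ℤ} (hF : LowTo F ω) (x : LampGroup) (i : ℤ) :
    ∀ᶠ z in F, lo ((z.lamps : Set ℤ) ∆ x.lamps) i = lo (ω ∆ x.lamps) i := by
  obtain ⟨⟨c, hc, hcF⟩, hk⟩ := hF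
  -- Pointwise convergence of the lamps suffices because only finitely many matter: below `c` both
  -- sets are empty, and positions from `i` on do not influence `lo _ i`.
  have hw : ∀ᶠ z in F, ∀ k ∈ Finset.Ico c i, (k ∈ z.lamps ↔ k ∈ ω) :=
    (Finset.eventually_all _).2 fun k _ => hk k
  filter_upwards [hw, hcF] with z hz hcz
  have key : ∀ k < i, (k ∈ z.lamps ↔ k ∈ ω) := by
    intro k hki
    by_cases hck : c ≤ k
    · exact hz k (Finset.mem_Ico.2 ⟨hck, hki⟩)
    · exact ⟨fun h => absurd (hcz.2 k h) hck, fun h => absurd (hc k h) hck⟩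
  refine lo_eq_of_le_iff (bddBelow_diff z x)
    (bddBelow_symmDiff ⟨c, hc⟩ (bddBelow_lamps x)) fun d => and_congr_right fun hd => ?_
  refine forall_congr' fun k => ?_
  simp only [Set.mem_symmDiff, Finset.mem_coe]
  by_cases hki : k < i
  · rw [key k hki]
  · have : d ≤ k := by omega
    simp [this]

/-- The horofunction with lamps `ω`, lamplighter at height `l`, and a lit lamp at `+∞`. -/
noncomputable def ribLimit (ω : Set ℤ) (l : ℤ) : LampGroup → ℝ := fun x =>
  ((2 * (lo ω (min l 0) - lo (ω ∆ x.lamps) (min l x.height)) : ℤ) : ℝ) + spineFun l x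

/-- The Busemann function of the point of the upper boundary with lamps `ω`. -/
noncomputable def busemann (ω : Set ℤ) : LampGroup → ℝ := fun x =>
  ((2 * (lo ω 0 - lo (ω ∆ x.lamps) x.height) + x.height : ℤ) : ℝ)

theorem spineFun_of_le {l : ℤ} {x : LampGroup} (h0 : 0 ≤ l) (hx : x.height ≤ l) :
    spineFun l x = x.height := by
  rw [spineFun, abs_of_nonneg h0, abs_of_nonneg (by omega)]
  push_cast
  ring

theorem LowTo.lowPart_eq {F : Filter LampGroup} {ω : Set ℤ} (hF : LowTo F ω) {l : ℤ}
    (hl : ∀ᶠ z in F, z.height = l) (x : LampGroup) :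
    ∀ᶠ z in F, lowPart z x = 2 * (lo ω (min l 0) - lo (ω ∆ x.lamps) (min l x.height)) := by
  filter_upwards [hl, hF.lo_eq 1 (min l 0), hF.lo_eq x (min l x.height)] with z h1 h2 h3
  have : ω ∆ ((1 : LampGroup).lamps : Set ℤ) = ω := by
    rw [one_lamps, Finset.coe_empty]; exact symmDiff_bot ω
  rw [this] at h2
  rw [lowPart, tourMin, tourMin, h1, one_height, h2, h3]

theorem LowTo.lowPart_eq_of_atTop {F : Filter LampGroup} {ω : Set ℤ} (hF : LowTo F ω)
    (hl : Tendsto height F atTop) (x : LampGroup) :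
    ∀ᶠ z in F, lowPart z x = 2 * (lo ω 0 - lo (ω ∆ x.lamps) x.height) := by
  filter_upwards [hl.eventually_ge_atTop (max 0 x.height), hF.lo_eq 1 0,
    hF.lo_eq x x.height] with z h1 h2 h3
  have : ω ∆ ((1 : LampGroup).lamps : Set ℤ) = ω := by
    rw [one_lamps, Finset.coe_empty]; exact symmDiff_bot ω
  rw [this] at h2
  rw [lowPart, tourMin, tourMin, one_height, min_eq_right (by omega), h2, min_eq_right (by omega), h3]

/-- All limits below are attained eventually at each point, so no estimates in `ℝ` are needed. -/
theorem tendsto_of_eventually_eq {F : Filter LampGroup} {h : LampGroup → ℝ}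
    (H : ∀ x, ∀ᶠ z in F, horoEmb z x = h x) : Tendsto horoEmb F (𝓝 h) :=
  tendsto_pi_nhds.2 fun x => tendsto_const_nhds.congr' ((H x).mono fun _ hz => hz.symm)

theorem tendsto_spineFun {F : Filter LampGroup} (h1 : LowInf F) (h2 : LowInf (F.map reflect)) {l : ℤ}
    (hl : ∀ᶠ z in F, z.height = l) : Tendsto horoEmb F (𝓝 (spineFun l)) := by
  refine tendsto_of_eventually_eq fun x => ?_
  filter_upwards [h1.lowPart_eq_zero x, eventually_map.1 (h2.lowPart_eq_zero (reflect x)), hl] with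
    z a b c
  rw [horoEmb_eq, a, b, c]
  simp

theorem tendsto_ribLimit {F : Filter LampGroup} {ω : Set ℤ} (h1 : LowTo F ω)
    (h2 : LowInf (F.map reflect)) {l : ℤ} (hl : ∀ᶠ z in F, z.height = l) :
    Tendsto horoEmb F (𝓝 (ribLimit ω l)) := by
  refine tendsto_of_eventually_eq fun x => ?_
  filter_upwards [h1.lowPart_eq hl x, eventually_map.1 (h2.lowPart_eq_zero (reflect x)), hl] with
    z a b c
  rw [horoEmb_eq, a, b, c, ribLimit]
  simp

theorem lowInf_reflect_of_atTop {F : Filter LampGroup} (hl : Tendsto height F atTop) :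
    LowInf (F.map reflect) := by
  intro c
  rw [eventually_map]
  filter_upwards [hl.eventually_gt_atTop (-c)] with z hz
  left
  rw [reflect_height]
  omega

theorem tendsto_heightFun {F : Filter LampGroup} (h1 : LowInf F) (hl : Tendsto height F atTop) :
    Tendsto horoEmb F (𝓝 heightFun) := by
  refine tendsto_of_eventually_eq fun x => ?_
  filter_upwards [h1.lowPart_eq_zero x,
    eventually_map.1 ((lowInf_reflect_of_atTop hl).lowPart_eq_zero (reflect x)),
    hl.eventually_ge_atTop (max 0 x.height)] with z a b c
  rw [horoEmb_eq, a, b, spineFun_of_le (by omega) (by omega), heightFun]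
  simp

theorem tendsto_busemann {F : Filter LampGroup} {ω : Set ℤ} (h1 : LowTo F ω)
    (hl : Tendsto height F atTop) : Tendsto horoEmb F (𝓝 (busemann ω)) := by
  refine tendsto_of_eventually_eq fun x => ?_
  filter_upwards [h1.lowPart_eq_of_atTop hl x,
    eventually_map.1 ((lowInf_reflect_of_atTop hl).lowPart_eq_zero (reflect x)),
    hl.eventually_ge_atTop (max 0 x.height)] with z a b c
  rw [horoEmb_eq, a, b, spineFun_of_le (by omega) (by omega), busemann]
  push_cast
  ring

/-! ### Reflection of functions -/

/-- Precomposition with the reflection. -/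
def pull (h : LampGroup → ℝ) : LampGroup → ℝ := fun x => h (reflect x)

@[simp] theorem pull_pull (h : LampGroup → ℝ) : pull (pull h) = h := by
  ext x; simp [pull]

theorem pull_injective : Function.Injective pull :=
  Function.LeftInverse.injective pull_pull

theorem continuous_pull : Continuous pull :=
  continuous_pi fun _ => continuous_apply _

theorem pull_horoEmb (z : LampGroup) : pull (horoEmb z) = horoEmb (reflect z) := by
  ext x
  simp only [pull, horoEmb]
  rw [← wdist_reflect, ← wdist_reflect z 1, reflect_reflect, reflect_one]

theorem pull_mem_range {h : LampGroup → ℝ} :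
    pull h ∈ Set.range horoEmb ↔ h ∈ Set.range horoEmb := by
  have key : ∀ h, h ∈ Set.range horoEmb → pull h ∈ Set.range horoEmb := by
    rintro _ ⟨z, rfl⟩
    exact ⟨_, (pull_horoEmb z).symm⟩
  exact ⟨fun H => by simpa using key _ H, key h⟩

theorem pull_mem_horoBoundary {h : LampGroup → ℝ} : pull h ∈ horoBoundary ↔ h ∈ horoBoundary := by
  have key : ∀ h, h ∈ horoBoundary → pull h ∈ horoBoundary := fun h hh =>
    ⟨map_mem_closure continuous_pull hh.1 fun x => pull_mem_range.2,
      fun H => hh.2 (pull_mem_range.1 H)⟩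
  exact ⟨fun H => by simpa using key _ H, key h⟩

theorem pull_act (g : LampGroup) (h : LampGroup → ℝ) :
    pull (act g h) = act (reflect g) (pull h) := by
  ext x
  simp [pull, act, reflect_mul, ← reflect_inv]

theorem pull_heightFun : pull heightFun = -heightFun := by
  ext x; simp [pull, heightFun]

theorem pull_neg_heightFun : pull (-heightFun) = heightFun := by
  rw [← pull_heightFun, pull_pull]

theorem pull_spineFun (l : ℤ) : pull (spineFun l) = spineFun (-l) := by
  ext x
  have : |l - -x.height| = |-l - x.height| := by rw [← abs_neg]; ring_nf
  simp only [pull, spineFun, reflect_height, this, abs_neg]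

theorem tendsto_pull {F : Filter LampGroup} {h : LampGroup → ℝ} (H : Tendsto horoEmb F (𝓝 h)) :
    Tendsto horoEmb (F.map reflect) (𝓝 (pull h)) := by
  rw [tendsto_map'_iff]
  have := (continuous_pull.tendsto h).comp H
  simpa only [Function.comp_def, pull_horoEmb] using this

/-! ### The ribs -/

theorem le_minThree_iff {x : WithTop ℤ} {i j c : ℤ} :
    c ≤ minThree x i j ↔ (c : WithTop ℤ) ≤ x ∧ c ≤ i ∧ c ≤ j := by
  induction x using WithTop.recTopCoe with
  | top =>
    rw [minThree, min_eq_right le_top, WithTop.untopD_coe, le_min_iff]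
    simp
  | coe x =>
    rw [minThree, ← WithTop.coe_min, WithTop.untopD_coe, WithTop.coe_le_coe, le_min_iff, le_min_iff]

theorem maxThree_le_iff {x : WithBot ℤ} {i j c : ℤ} :
    maxThree x i j ≤ c ↔ x ≤ (c : WithBot ℤ) ∧ i ≤ c ∧ j ≤ c := by
  induction x using WithBot.recBotCoe with
  | bot =>
    rw [maxThree, max_eq_right bot_le, WithBot.unbotD_coe, max_le_iff]
    simp
  | coe x =>
    rw [maxThree, ← WithBot.coe_max, WithBot.unbotD_coe, WithBot.coe_le_coe, max_le_iff, max_le_iff]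

theorem minThree_min_eq (s : Finset ℤ) (i j : ℤ) : minThree s.min i j = lo s (min i j) := by
  refine eq_of_forall_le_iff fun c => ?_
  rw [le_minThree_iff, le_lo_iff s.bddBelow, le_min_iff, Finset.le_min_iff, and_comm]
  simp

/-- The `+ 1` in the negative ribs is the upper endpoint of the edge of lamp `k`: reflecting sends
lamp `k` to `-1 - k`, whose negative is `k + 1`. -/
theorem maxThree_max_eq (s t : Finset ℤ) (ht : ∀ k, k ∈ t ↔ -1 - k ∈ s) (i j : ℤ) :
    maxThree (s.max + 1) i j = -lo t (min (-i) (-j)) := by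
  refine eq_of_forall_ge_iff fun c => ?_
  have : -lo (t : Set ℤ) (min (-i) (-j)) ≤ c ↔ -c ≤ lo t (min (-i) (-j)) := by omega
  rw [maxThree_le_iff, this, le_lo_iff t.bddBelow, le_min_iff, and_comm, neg_le_neg_iff,
    neg_le_neg_iff]
  refine and_congr_right fun _ => ?_
  have h1 : s.max + 1 ≤ (c : WithBot ℤ) ↔ s.max ≤ ((c - 1 : ℤ) : WithBot ℤ) := by
    generalize s.max = y
    induction y using WithBot.recBotCoe with
    | bot => simp
    | coe y =>
      rw [← WithBot.coe_one, ← WithBot.coe_add, WithBot.coe_le_coe, WithBot.coe_le_coe]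
      omega
  rw [h1, Finset.max_le_iff]
  simp only [WithBot.coe_le_coe, Finset.mem_coe]
  constructor
  · intro h k hk
    have := h _ ((ht k).1 hk); omega
  · intro h k hk
    have := h (-1 - k) ((ht _).2 (by simpa using hk)); omega

theorem ribPlusFun_eq (f : LampGroup) : ribPlusFun f = ribLimit f.lamps f.height := by
  ext x
  rw [ribPlusFun, ribLimit, minLamp, minDiff, minThree_min_eq, minThree_min_eq,
    Finset.coe_symmDiff, min_comm x.height]

theorem ribMinusFun_eq (f : LampGroup) : ribMinusFun f = pull (ribPlusFun (reflect f)) := by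
  rw [ribPlusFun_eq]
  ext x
  have h : spineFun (-f.height) (reflect x) = spineFun f.height x := by
    rw [← pull_spineFun, pull, reflect_reflect]
  rw [ribMinusFun, pull, ribLimit, maxLamp, maxDiff,
    maxThree_max_eq (f.lamps) (reflect f).lamps (fun k => mem_reflect_lamps),
    maxThree_max_eq (f.lamps ∆ x.lamps) ((reflect f).lamps ∆ (reflect x).lamps)
      (fun k => by simp [Finset.mem_symmDiff]),
    Finset.coe_symmDiff, min_comm (-x.height)]
  simp only [reflect_height, h, neg_zero]
  push_cast
  ring

theorem maxLamp_lt_iff {f : LampGroup} {l : ℤ} :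
    maxLamp f < (l : WithBot ℤ) ↔ ∀ k ∈ f.lamps, k < l := by
  rw [maxLamp, Finset.max_eq_sup_withBot, Finset.sup_lt_iff (WithBot.bot_lt_coe l)]
  simp

theorem le_minLamp_iff {f : LampGroup} {l : ℤ} :
    (l : WithTop ℤ) ≤ minLamp f ↔ ∀ k ∈ f.lamps, l ≤ k := by
  rw [minLamp, Finset.le_min_iff]
  simp

theorem ribsMinus_eq : ribsMinus = pull '' ribsPlus := by
  ext h
  simp only [ribsMinus, ribsPlus, Set.mem_ofPred_eq, Set.mem_image, le_minLamp_iff, maxLamp_lt_iff]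
  constructor
  · rintro ⟨f, hf, rfl⟩
    refine ⟨_, ⟨reflect f, fun k hk => ?_, rfl⟩, (ribMinusFun_eq f).symm⟩
    have := hf _ (mem_reflect_lamps.1 hk)
    rw [reflect_height]; omega
  · rintro ⟨_, ⟨f, hf, rfl⟩, rfl⟩
    refine ⟨reflect f, fun k hk => ?_, by rw [ribMinusFun_eq, reflect_reflect]⟩
    have := hf _ (mem_reflect_lamps.1 hk)
    rw [reflect_height]; omega

/-- The lamp stand with lamps `ω ∩ (-∞, l)` and the lamplighter at `l`, for `ω` bounded below. -/
noncomputable def canon (ω : Set ℤ) (l : ℤ) : LampGroup :=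
  ⟨open Classical in (Finset.Ico (lo ω l) l).filter (· ∈ ω), l⟩

@[simp] theorem canon_height (ω : Set ℤ) (l : ℤ) : (canon ω l).height = l := rfl

theorem mem_canon {ω : Set ℤ} (hω : BddBelow ω) {l k : ℤ} :
    k ∈ (canon ω l).lamps ↔ k ∈ ω ∧ k < l := by
  simp only [canon, Finset.mem_filter, Finset.mem_Ico]
  constructor
  · tauto
  · rintro ⟨h1, h2⟩
    exact ⟨⟨lo_le_of_mem hω h1, h2⟩, h1⟩

theorem lo_symmDiff_congr {ω ω' : Set ℤ} (hω : BddBelow ω) (hω' : BddBelow ω') (x : LampGroup) {i : ℤ}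
    (h : ∀ k < i, k ∈ ω ↔ k ∈ ω') : lo (ω ∆ x.lamps) i = lo (ω' ∆ x.lamps) i := by
  refine lo_eq_of_le_iff (bddBelow_symmDiff hω (bddBelow_lamps x))
    (bddBelow_symmDiff hω' (bddBelow_lamps x)) fun d => and_congr_right fun hd => ?_
  refine forall_congr' fun k => ?_
  simp only [Set.mem_symmDiff, Finset.mem_coe]
  by_cases hki : k < i
  · rw [h k hki]
  · have : d ≤ k := by omega
    simp [this]

theorem symmDiff_one_lamps (ω : Set ℤ) : ω ∆ ((1 : LampGroup).lamps : Set ℤ) = ω := by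
  rw [one_lamps, Finset.coe_empty]; exact symmDiff_bot ω

theorem ribLimit_congr {ω ω' : Set ℤ} (hω : BddBelow ω) (hω' : BddBelow ω') {l : ℤ}
    (h : ∀ k < l, k ∈ ω ↔ k ∈ ω') : ribLimit ω l = ribLimit ω' l := by
  ext x
  rw [ribLimit, ribLimit, lo_symmDiff_congr hω hω' x fun k hk => h k (by omega)]
  have := lo_symmDiff_congr hω hω' 1 (i := min l 0) fun k hk => h k (by omega)
  rw [symmDiff_one_lamps, symmDiff_one_lamps] at this
  rw [this]

/-- `ribLimit ω l` ignores the lamps at or above `l`, so the normalisation `M(f) < H(f)` can be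
dropped. Without it the family is visibly stable under `move g`, which may light lamps above the new
height. -/
theorem ribsPlus_eq : ribsPlus = {h | ∃ ω l, BddBelow ω ∧ h = ribLimit ω l} := by
  ext h
  simp only [ribsPlus, Set.mem_ofPred_eq, maxLamp_lt_iff]
  constructor
  · rintro ⟨f, -, rfl⟩
    exact ⟨_, _, bddBelow_lamps f, ribPlusFun_eq f⟩
  · rintro ⟨ω, l, hω, rfl⟩
    refine ⟨canon ω l, fun k hk => ((mem_canon hω).1 hk).2, ?_⟩
    rw [ribPlusFun_eq]
    refine ribLimit_congr hω (bddBelow_lamps _) fun k hk => ?_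
    simp [mem_canon hω, hk]

/-! ### Classification of the boundary points -/

/-- For an ultrafilter, the failure of escape is an eventual uniform lower bound, and each lamp is
eventually on or eventually off; `ω` collects those eventually on. -/
theorem lowInf_or_lowTo (U : Ultrafilter LampGroup) : LowInf U ∨ ∃ ω, LowTo U ω := by
  refine or_iff_not_imp_left.2 fun h => ?_
  simp only [LowInf, not_forall] at h
  obtain ⟨c, hc⟩ := h
  rw [← Ultrafilter.eventually_not] at hc
  push Not at hc
  refine ⟨{k | ∀ᶠ z in (U : Filter LampGroup), k ∈ z.lamps}, ⟨c, fun k hk => ?_, hc⟩, fun k => ?_⟩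
  · obtain ⟨z, hz, hz'⟩ := (hc.and hk).exists
    exact hz.2 k hz'
  · by_cases hk : ∀ᶠ z in (U : Filter LampGroup), k ∈ z.lamps
    · filter_upwards [hk] with z hz
      simp [hz, hk]
    · have := Ultrafilter.eventually_not.2 hk
      filter_upwards [this] with z hz
      simp [hz, hk]

theorem height_trichotomy (U : Ultrafilter LampGroup) :
    (∃ l, ∀ᶠ z in (U : Filter LampGroup), z.height = l) ∨ Tendsto height U atTop ∨
      Tendsto height U atBot := by
  by_cases h1 : Tendsto height U atTop
  · exact Or.inr (Or.inl h1)
  by_cases h2 : Tendsto height U atBot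
  · exact Or.inr (Or.inr h2)
  left
  simp only [tendsto_atTop, tendsto_atBot, not_forall] at h1 h2
  obtain ⟨a, ha⟩ := h1
  obtain ⟨b, hb⟩ := h2
  rw [← Ultrafilter.eventually_not] at ha hb
  have : ∀ᶠ z in (U : Filter LampGroup), ∃ l ∈ Finset.Icc b a, z.height = l := by
    filter_upwards [ha, hb] with z h1 h2
    exact ⟨_, Finset.mem_Icc.2 ⟨by omega, by omega⟩, rfl⟩
  obtain ⟨l, -, hl⟩ := (Ultrafilter.eventually_exists_mem_iff (Finset.finite_toSet _)).1 this
  exact ⟨l, hl⟩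

theorem tendsto_height_reflect {F : Filter LampGroup} (h : Tendsto height F atBot) :
    Tendsto height (F.map reflect) atTop := by
  rw [tendsto_map'_iff]
  exact tendsto_neg_atBot_atTop.comp h

/-- Bounds at both ends confine `z` to a finite set of lamp stands, where an ultrafilter is
principal. -/
theorem exists_const_of_lowTo {U : Ultrafilter LampGroup} {ω ω' : Set ℤ} (h1 : LowTo U ω)
    (h2 : LowTo ((U : Filter LampGroup).map reflect) ω') :
    ∃ z₀, ∀ᶠ z in (U : Filter LampGroup), z = z₀ := by
  obtain ⟨⟨a, -, ha⟩, -⟩ := h1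
  obtain ⟨⟨b, -, hb⟩, -⟩ := h2
  rw [eventually_map] at hb
  have hfin : {z : LampGroup | (a ≤ z.height ∧ ∀ k ∈ z.lamps, a ≤ k) ∧
      b ≤ (reflect z).height ∧ ∀ k ∈ (reflect z).lamps, b ≤ k}.Finite := by
    refine Set.Finite.subset (((Finset.Icc a (-b)).powerset ×ˢ Finset.Icc a (-b)).finite_toSet.image
      fun p : Finset ℤ × ℤ => (⟨p.1, p.2⟩ : LampGroup)) ?_
    rintro z ⟨⟨h1, h2⟩, h3, h4⟩
    simp only [Set.mem_image, Finset.mem_coe, Finset.mem_product,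
      Finset.mem_powerset]
    refine ⟨(z.lamps, z.height), ⟨fun k hk => ?_, ?_⟩, rfl⟩
    · have := h2 k hk
      have := h4 (-1 - k) (by simpa using hk)
      rw [Finset.mem_Icc]; omega
    · rw [reflect_height] at h3
      rw [Finset.mem_Icc]; omega
  have : ∀ᶠ z in (U : Filter LampGroup), ∃ z₀ ∈ {z : LampGroup | (a ≤ z.height ∧ ∀ k ∈ z.lamps, a ≤ k) ∧
      b ≤ (reflect z).height ∧ ∀ k ∈ (reflect z).lamps, b ≤ k}, z = z₀ := by
    filter_upwards [ha, hb] with z h1 h2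
    exact ⟨z, ⟨h1, h2⟩, rfl⟩
  obtain ⟨z₀, -, h⟩ := (Ultrafilter.eventually_exists_mem_iff hfin).1 this
  exact ⟨z₀, h⟩

theorem not_lowTo_of_atBot {U : Ultrafilter LampGroup} {ω : Set ℤ} (h : LowTo U ω) :
    ¬ Tendsto height U atBot := by
  intro H
  obtain ⟨⟨c, -, hc⟩, -⟩ := h
  obtain ⟨z, hz, hz'⟩ := (hc.and (H.eventually_lt_atBot c)).exists
  omega

/-- The points `busemann ω` of the upper part of the boundary. -/
def upper : Set (LampGroup → ℝ) := {h | ∃ ω, BddBelow ω ∧ h = busemann ω}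

theorem horoBoundary_classification {h : LampGroup → ℝ} (hh : h ∈ horoBoundary) :
    h ∈ upper ∨ pull h ∈ upper ∨ h ∈ spine ∨ h ∈ ribsPlus ∨ pull h ∈ ribsPlus ∨ h = heightFun ∨
      h = -heightFun := by
  obtain ⟨hc, hr⟩ := hh
  -- An ultrafilter converging to `h` replaces the extraction of subsequences.
  have hne : (comap horoEmb (𝓝 h)).NeBot := comap_neBot_iff_frequently.2 (mem_closure_iff_frequently.1 hc)
  set U := Ultrafilter.of (comap horoEmb (𝓝 h))
  have hU : Tendsto horoEmb U (𝓝 h) := tendsto_comap.mono_left (Ultrafilter.of_le _)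
  have hU' : Tendsto horoEmb ((U : Filter LampGroup).map reflect) (𝓝 (pull h)) := tendsto_pull hU
  have uniq : ∀ {k}, Tendsto horoEmb U (𝓝 k) → h = k := fun hk => tendsto_nhds_unique hU hk
  have uniq' : ∀ {k}, Tendsto horoEmb ((U : Filter LampGroup).map reflect) (𝓝 k) → pull h = k :=
    fun hk => tendsto_nhds_unique hU' hk
  have hself : ((U : Filter LampGroup).map reflect).map reflect = U := by
    rw [Filter.map_map]
    convert Filter.map_id
    ext1 z; simp
  rcases lowInf_or_lowTo U with h1 | ⟨ω, h1⟩ <;>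
  rcases lowInf_or_lowTo (U.map reflect) with h2 | ⟨ω', h2⟩ <;>
  rw [Ultrafilter.coe_map] at h2
  · rcases height_trichotomy U with ⟨l, hl⟩ | hl | hl
    · exact Or.inr (Or.inr (Or.inl ⟨l, (uniq (tendsto_spineFun h1 h2 hl)).symm⟩))
    · have := uniq (tendsto_heightFun h1 hl); tauto
    · have := uniq' (tendsto_heightFun h2 (tendsto_height_reflect hl))
      rw [← pull_neg_heightFun] at this
      have := pull_injective this
      tauto
  · rcases height_trichotomy U with ⟨l, hl⟩ | hl | hl
    · have := uniq' (tendsto_ribLimit h2 (by rwa [hself]) (l := -l)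
        (eventually_map.2 (hl.mono fun z hz => by rw [reflect_height, hz])))
      have : pull h ∈ ribsPlus := by rw [ribsPlus_eq]; exact ⟨ω', -l, h2.bddBelow, this⟩
      tauto
    -- The upper end is bounded, so the height cannot tend to `+∞`.
    · refine absurd ?_ (not_lowTo_of_atBot (U := U.map reflect) (by rwa [Ultrafilter.coe_map]))
      rw [Ultrafilter.coe_map, tendsto_map'_iff]
      exact tendsto_neg_atTop_atBot.comp hl
    · exact Or.inr (Or.inl ⟨ω', h2.bddBelow,
        uniq' (tendsto_busemann h2 (tendsto_height_reflect hl))⟩)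
  · rcases height_trichotomy U with ⟨l, hl⟩ | hl | hl
    · have := uniq (tendsto_ribLimit h1 h2 hl)
      have : h ∈ ribsPlus := by rw [ribsPlus_eq]; exact ⟨ω, l, h1.bddBelow, this⟩
      tauto
    · exact Or.inl ⟨ω, h1.bddBelow, uniq (tendsto_busemann h1 hl)⟩
    · exact absurd hl (not_lowTo_of_atBot h1)
  · obtain ⟨z₀, hz⟩ := exists_const_of_lowTo h1 h2
    refine absurd ⟨z₀, ?_⟩ hr
    exact (uniq (tendsto_const_nhds.congr' (hz.mono fun z hz => by rw [hz]))).symm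

/-! ### The action on sets of lamps and on horofunctions -/

/-- The action of the group on sets of lit lamps. -/
def move (g : LampGroup) (ω : Set ℤ) : Set ℤ := {j | ¬ (j ∈ g.lamps ↔ j - g.height ∈ ω)}

theorem mem_move {g : LampGroup} {ω : Set ℤ} {j : ℤ} :
    j ∈ move g ω ↔ ¬ (j ∈ g.lamps ↔ j - g.height ∈ ω) := Iff.rfl

theorem move_one (ω : Set ℤ) : move 1 ω = ω := by
  ext j; simp [mem_move]

theorem move_mul (g k : LampGroup) (ω : Set ℤ) : move (g * k) ω = move g (move k ω) := by
  ext j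
  simp only [mem_move, mul_lamps, mul_height, Finset.mem_symmDiff, mem_vadd_finset_int, sub_sub]
  tauto

theorem bddBelow_move (g : LampGroup) {ω : Set ℤ} (hω : BddBelow ω) : BddBelow (move g ω) := by
  obtain ⟨c, hc⟩ := hω
  obtain ⟨d, hd⟩ := bddBelow_lamps g
  refine ⟨min (c + g.height) d, fun j hj => ?_⟩
  rw [mem_move] at hj
  by_cases h : j ∈ g.lamps
  · have : d ≤ j := hd h
    omega
  · have : c ≤ j - g.height := hc (by tauto)
    omega

/-- Translating a configuration by `g` shifts the lower end of every tour by the height of `g`; this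
shift cancels in the differences that define horofunctions. -/
theorem lo_move (g x : LampGroup) {ω : Set ℤ} (hω : BddBelow ω) {i j : ℤ} (hj : j = g.height + i) :
    lo (move g ω ∆ x.lamps) j = g.height + lo (ω ∆ (g⁻¹ * x).lamps) i := by
  refine lo_translate (bddBelow_symmDiff hω (bddBelow_lamps _)) hj fun k => ?_
  simp only [Set.mem_symmDiff, Finset.mem_coe, mem_move, mul_lamps, inv_lamps, inv_height,
    Finset.mem_symmDiff, mem_vadd_finset_int]
  simp only [sub_neg_eq_add, sub_add_cancel]
  tauto

theorem lo_move_one (g : LampGroup) {ω : Set ℤ} (hω : BddBelow ω) {i j : ℤ}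
    (hj : j = g.height + i) : lo (move g ω) j = g.height + lo (ω ∆ g⁻¹.lamps) i := by
  have := lo_move g 1 hω hj
  rwa [symmDiff_one_lamps, mul_one] at this

theorem act_busemann (g : LampGroup) {ω : Set ℤ} (hω : BddBelow ω) :
    act g (busemann ω) = busemann (move g ω) := by
  ext x
  simp only [act, busemann]
  rw [lo_move g x hω (i := (g⁻¹ * x).height) (by simp),
    lo_move_one g hω (i := g⁻¹.height) (by simp)]
  simp only [mul_height, inv_height]
  push_cast
  ring

theorem act_heightFun (g : LampGroup) : act g heightFun = heightFun := by
  ext x; simp [act, heightFun]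

theorem act_neg_heightFun (g : LampGroup) : act g (-heightFun) = -heightFun := by
  ext x; simp [act, heightFun]

theorem act_spineFun (g : LampGroup) (l : ℤ) : act g (spineFun l) = spineFun (l + g.height) := by
  ext x
  simp only [act, spineFun, mul_height, inv_height]
  rw [show l - (-g.height + x.height) = l + g.height - x.height by ring, sub_neg_eq_add]
  push_cast
  ring

theorem act_ribLimit (g : LampGroup) {ω : Set ℤ} (hω : BddBelow ω) (l : ℤ) :
    act g (ribLimit ω l) = ribLimit (move g ω) (l + g.height) := by
  ext x
  have h := congrFun (act_spineFun g l) x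
  simp only [act] at h
  simp only [act, ribLimit]
  rw [lo_move g x hω (i := min l (g⁻¹ * x).height) (by simp only [mul_height, inv_height]; omega),
    lo_move_one g hω (i := min l g⁻¹.height) (by simp only [inv_height]; omega), ← h]
  push_cast
  ring

/-! ### The families lie in the boundary -/

theorem notMem_range_of_unbounded {h : LampGroup → ℝ} (H : ∀ C : ℝ, ∃ x, h x < C) :
    h ∉ Set.range horoEmb := by
  rintro ⟨z, rfl⟩
  obtain ⟨x, hx⟩ := H (-(wdist z 1 : ℝ))
  have : (0 : ℝ) ≤ wdist z x := Nat.cast_nonneg _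
  simp only [horoEmb] at hx
  linarith

/-- Each `horoEmb z` is bounded below by `-d(z, id)`, so a function that decreases at unit rate
along some sequence is not of this form. -/
theorem notMem_range_of_eq {h : LampGroup → ℝ} (x : ℤ → LampGroup) (N K : ℤ)
    (H : ∀ n ≥ N, h (x n) = ((K - n : ℤ) : ℝ)) : h ∉ Set.range horoEmb := by
  refine notMem_range_of_unbounded fun C => ?_
  obtain ⟨m, hm⟩ := exists_int_gt (K - C)
  refine ⟨x (max N m), ?_⟩
  rw [H _ (le_max_left _ _)]
  have : (m : ℝ) ≤ (max N m : ℤ) := by exact_mod_cast le_max_right N m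
  push_cast at *
  linarith

theorem mem_horoCompactification_of_tendsto {y : ℕ → LampGroup} {h : LampGroup → ℝ}
    (H : Tendsto horoEmb (map y atTop) (𝓝 h)) : h ∈ horoCompactification :=
  mem_closure_of_tendsto H (Eventually.of_forall fun z => ⟨z, rfl⟩)

theorem lowInf_map_of_mem {y : ℕ → LampGroup} (H : ∀ n : ℕ, -(n : ℤ) ∈ (y n).lamps) :
    LowInf (map y atTop) := by
  intro c
  rw [eventually_map]
  filter_upwards [eventually_gt_atTop (-c).toNat] with n hn
  exact Or.inr ⟨_, H n, by omega⟩

theorem lowInf_map_reflect_of_mem {y : ℕ → LampGroup} (H : ∀ n : ℕ, (n : ℤ) ∈ (y n).lamps) :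
    LowInf ((map y atTop).map reflect) := by
  intro c
  rw [eventually_map, eventually_map]
  filter_upwards [eventually_gt_atTop (-c).toNat] with n hn
  exact Or.inr ⟨-1 - n, by simpa using H n, by omega⟩

theorem tendsto_intCast_add (s : ℤ) : Tendsto (fun n : ℕ => (n : ℤ) + s) atTop atTop :=
  tendsto_atTop_add_const_right _ _ tendsto_natCast_atTop_atTop

theorem heightFun_mem_horoBoundary : heightFun ∈ horoBoundary := by
  refine ⟨mem_horoCompactification_of_tendsto (y := fun n : ℕ => ⟨{-(n : ℤ)}, n⟩)
    (tendsto_heightFun (lowInf_map_of_mem (by simp)) ?_),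
    notMem_range_of_eq (fun n => ⟨∅, -n⟩) 0 0 fun n _ => by simp [heightFun]⟩
  rw [tendsto_map'_iff]
  exact tendsto_natCast_atTop_atTop

theorem neg_heightFun_mem_horoBoundary : -heightFun ∈ horoBoundary := by
  rw [← pull_heightFun, pull_mem_horoBoundary]
  exact heightFun_mem_horoBoundary

theorem spineFun_mem_horoBoundary (l : ℤ) : spineFun l ∈ horoBoundary := by
  refine ⟨mem_horoCompactification_of_tendsto (y := fun n : ℕ => ⟨{-(n : ℤ), (n : ℤ)}, l⟩)
    (tendsto_spineFun (lowInf_map_of_mem (by simp)) (lowInf_map_reflect_of_mem (by simp)) ?_),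
    notMem_range_of_eq (fun n => ⟨∅, n⟩) l (|l| + l) fun n hn => ?_⟩
  · simp [eventually_map]
  · have : |l - n| = n - l := by rw [abs_of_nonpos (by omega)]; ring
    rw [spineFun, this]
    congr 1
    ring

theorem ribLimit_mem_horoBoundary {ω : Set ℤ} (hω : BddBelow ω) (l : ℤ) :
    ribLimit ω l ∈ horoBoundary := by
  have hc := bddBelow_lamps (canon ω l)
  rw [ribLimit_congr hω hc (l := l) fun k hk => by simp [mem_canon hω, hk]]
  set f := canon ω l
  refine ⟨mem_horoCompactification_of_tendsto (y := fun n : ℕ => ⟨insert (n : ℤ) f.lamps, l⟩)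
    (tendsto_ribLimit ⟨?_, fun k => ?_⟩ (lowInf_map_reflect_of_mem (by simp)) ?_),
    notMem_range_of_eq (fun n => ⟨f.lamps, n⟩) l (2 * (lo f.lamps (min l 0) - l) + |l| + l)
      fun n hn => ?_⟩
  · obtain ⟨c, hc⟩ := hc
    refine ⟨min 0 (min c l), fun k hk => ?_, ?_⟩
    · have : c ≤ k := hc hk
      omega
    · refine eventually_map.2 (Eventually.of_forall fun n => ⟨(by omega : _ ≤ l), fun k hk => ?_⟩)
      rcases Finset.mem_insert.1 hk with rfl | hk
      · omega
      · have : c ≤ k := hc hk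
        omega
  · rw [eventually_map]
    filter_upwards [eventually_gt_atTop k.toNat] with n hn
    rw [Finset.mem_insert]
    exact ⟨fun h => h.resolve_left (by omega), Or.inr⟩
  · simp [eventually_map]
  · have h1 : |l - n| = n - l := by rw [abs_of_nonpos (by omega)]; ring
    have h2 : lo ((f.lamps : Set ℤ) ∆ f.lamps) (min l n) = l := by
      rw [min_eq_left hn, symmDiff_self]
      exact lo_eq_self (by simp)
    simp only [ribLimit, spineFun, h1, h2]
    push_cast
    ring

theorem lo_canon {ω : Set ℤ} (hω : BddBelow ω) (n : ℤ) : lo (ω ∆ (canon ω n).lamps) n = n := by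
  refine lo_eq_self fun k hk => ?_
  rw [Set.mem_symmDiff, Finset.mem_coe, mem_canon hω] at hk
  by_contra h
  have : k < n := by omega
  tauto

theorem busemann_canon {ω : Set ℤ} (hω : BddBelow ω) (n : ℤ) :
    busemann ω (canon ω n) = ((2 * lo ω 0 - n : ℤ) : ℝ) := by
  rw [busemann, canon_height, lo_canon hω]
  congr 1
  ring

theorem tendsto_horoEmb_of_eventually_canon {ω : Set ℤ} (hω : BddBelow ω) {y : ℕ → LampGroup}
    {s : ℤ} (H : ∀ᶠ n : ℕ in atTop, y n = canon ω (n + s)) :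
    Tendsto (fun n => horoEmb (y n)) atTop (𝓝 (busemann ω)) := by
  have key : Tendsto horoEmb (map (fun n : ℕ => canon ω (n + s)) atTop) (𝓝 (busemann ω)) := by
    refine tendsto_busemann ⟨?_, fun k => ?_⟩ ?_
    · obtain ⟨c, hc⟩ := id hω
      refine ⟨c, fun k hk => hc hk, ?_⟩
      rw [eventually_map]
      filter_upwards [(tendsto_intCast_add s).eventually_ge_atTop c] with n hn
      exact ⟨hn, fun k hk => hc ((mem_canon hω).1 hk).1⟩
    · rw [eventually_map]
      filter_upwards [(tendsto_intCast_add s).eventually_gt_atTop k] with n hn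
      rw [mem_canon hω]
      tauto
    · rw [tendsto_map'_iff]
      exact tendsto_intCast_add s
  exact (tendsto_map'_iff.1 key).congr' (H.mono fun n hn => by simp [hn])

theorem busemann_mem_horoBoundary {ω : Set ℤ} (hω : BddBelow ω) : busemann ω ∈ horoBoundary := by
  refine ⟨mem_closure_of_tendsto (tendsto_horoEmb_of_eventually_canon hω (s := 0)
    (y := fun n => canon ω (n + 0)) (Eventually.of_forall fun n => rfl))
      (Eventually.of_forall fun n => ⟨_, rfl⟩),
    notMem_range_of_eq (canon ω) 0 (2 * lo ω 0) fun n _ => busemann_canon hω n⟩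

/-- Climbing along `canon ω`, the function `busemann ω` decreases forever, whereas `busemann ω'`
eventually increases if `ω'` differs from `ω` at some `k`. -/
theorem busemann_injective {ω ω' : Set ℤ} (hω : BddBelow ω) (hω' : BddBelow ω')
    (h : busemann ω = busemann ω') : ω = ω' := by
  by_contra hne
  obtain ⟨k, hk⟩ : ∃ k, ¬ (k ∈ ω ↔ k ∈ ω') := by
    by_contra H
    push Not at H
    exact hne (Set.ext H)
  -- Equality of the two values at `canon ω n` would give `2 * lo ω 0 - n ≥ 2 * (lo ω' 0 - k) + n`,
  -- which fails for this `n`.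
  obtain ⟨n, hn⟩ : ∃ n, n = max (k + 1) (lo ω 0 - lo ω' 0 + k + 1) := ⟨_, rfl⟩
  have h1 := congrFun h (canon ω n)
  rw [busemann_canon hω, busemann, Int.cast_inj, canon_height] at h1
  have h2 : lo (ω' ∆ (canon ω n).lamps) n ≤ k := by
    refine lo_le_of_mem (bddBelow_symmDiff hω' (bddBelow_lamps _)) ?_
    rw [Set.mem_symmDiff, Finset.mem_coe, mem_canon hω]
    have : k < n := by omega
    tauto
  omega

/-! ### Geodesic rays -/

theorem wdist_eq_one {z x : LampGroup} (h : wdist z x = 1) :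
    (x.height = z.height + 1 ∨ x.height = z.height - 1) ∧
      ∀ k, ¬ (k ∈ z.lamps ↔ k ∈ x.lamps) → k = min z.height x.height := by
  have h0 := wdist_eq z x
  obtain ⟨a1, a2, a3⟩ := le_tourMin_iff.1 (le_refl (tourMin z x))
  obtain ⟨b1, b2, b3⟩ := le_tourMin_reflect_iff.1 (le_refl (tourMin (reflect z) (reflect x)))
  rw [h] at h0
  have h1 : x.height = z.height + 1 ∨ x.height = z.height - 1 := by
    rcases abs_cases (z.height - x.height) with h | h <;> omega
  refine ⟨h1, fun k hk => ?_⟩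
  have := a3 k hk
  have := b3 k hk
  rcases abs_cases (z.height - x.height) with h | h <;> omega

theorem wdist_le_of_range {z x : LampGroup} {a b : ℤ} (hz : a ≤ z.height ∧ z.height ≤ b)
    (hx : a ≤ x.height ∧ x.height ≤ b) (h : ∀ k, ¬ (k ∈ z.lamps ↔ k ∈ x.lamps) → a ≤ k ∧ k < b) :
    (wdist z x : ℤ) ≤ 2 * (b - a) - |z.height - x.height| := by
  have h1 : a ≤ tourMin z x := le_tourMin_iff.2 ⟨hz.1, hx.1, fun k hk => (h k hk).1⟩
  have h2 : -b ≤ tourMin (reflect z) (reflect x) :=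
    le_tourMin_reflect_iff.2 ⟨by omega, by omega, fun k hk => by have := (h k hk).2; omega⟩
  rw [wdist_eq]
  omega

namespace Ray

variable (γ : Ray)

theorem step (n : ℕ) : wdist (γ.pt n) (γ.pt (n + 1)) = 1 := by
  rw [γ.isometric n (n + 1) (by omega)]; omega

theorem height_succ (n : ℕ) : (γ.pt (n + 1)).height = (γ.pt n).height + 1 ∨
    (γ.pt (n + 1)).height = (γ.pt n).height - 1 := (wdist_eq_one (γ.step n)).1

theorem mem_lamps_succ {n : ℕ} {k : ℤ} (h : k ≠ min (γ.pt n).height (γ.pt (n + 1)).height) :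
    k ∈ (γ.pt n).lamps ↔ k ∈ (γ.pt (n + 1)).lamps := by
  by_contra H
  exact h ((wdist_eq_one (γ.step n)).2 k H)

theorem height_le {i j : ℕ} (h : i ≤ j) :
    (γ.pt j).height - (γ.pt i).height ≤ j - i ∧ (γ.pt i).height - (γ.pt j).height ≤ j - i := by
  induction j, h using Nat.le_induction with
  | base => simp
  | succ j hj ih => have := γ.height_succ j; omega

theorem mem_lamps_of_range {i j : ℕ} (hij : i ≤ j) {a b : ℤ}
    (h : ∀ m, i ≤ m → m ≤ j → a ≤ (γ.pt m).height ∧ (γ.pt m).height ≤ b) (k : ℤ)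
    (hk : ¬ (k ∈ (γ.pt i).lamps ↔ k ∈ (γ.pt j).lamps)) : a ≤ k ∧ k < b := by
  induction j, hij using Nat.le_induction with
  | base => tauto
  | succ j hj ih =>
    by_cases H : k ∈ (γ.pt i).lamps ↔ k ∈ (γ.pt j).lamps
    · have h1 : k = min (γ.pt j).height (γ.pt (j + 1)).height := by
        by_contra h'
        exact hk (H.trans (γ.mem_lamps_succ h'))
      have h2 := h j hj (by omega)
      have h3 := h (j + 1) (by omega) le_rfl
      have h4 := γ.height_succ j
      omega
    · exact ih (fun m h1 h2 => h m h1 (by omega)) H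

/-- A path staying in heights `[a, b]` changes only lamps in `[a, b)`, so its endpoints are joined
by a tour sweeping that interval; a geodesic is no longer than this tour. -/
theorem sub_le_of_range {i j : ℕ} (hij : i ≤ j) {a b : ℤ}
    (h : ∀ m, i ≤ m → m ≤ j → a ≤ (γ.pt m).height ∧ (γ.pt m).height ≤ b) :
    (j : ℤ) - i ≤ 2 * (b - a) - |(γ.pt i).height - (γ.pt j).height| := by
  have := wdist_le_of_range (h i le_rfl hij) (h j hij le_rfl) (γ.mem_lamps_of_range hij h)
  rw [γ.isometric i j hij] at this
  omega

theorem unbounded : (∀ c, ∃ n, c < (γ.pt n).height) ∨ ∀ c, ∃ n, (γ.pt n).height < c := by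
  by_contra! H
  obtain ⟨⟨b, hb⟩, a, ha⟩ := H
  have := γ.sub_le_of_range (Nat.zero_le (2 * (b - a) + 1).toNat) fun m _ _ => ⟨ha m, hb m⟩
  have h2 := abs_nonneg ((γ.pt 0).height - (γ.pt (2 * (b - a) + 1).toNat).height)
  omega

variable {γ}

/-- A ray that goes up and at once down must later regain the lost height. The first edge is then
crossed three times, which is too long for a geodesic in that height range. -/
theorem not_up_down (hγ : ∀ c, ∃ n, c < (γ.pt n).height) {i : ℕ}
    (h1 : (γ.pt (i + 1)).height = (γ.pt i).height + 1) :
    (γ.pt (i + 2)).height = (γ.pt (i + 1)).height + 1 := by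
  refine (γ.height_succ (i + 1)).resolve_right fun h2 => ?_
  replace h2 : (γ.pt (i + 2)).height = (γ.pt (i + 1)).height - 1 := h2
  have hex : ∃ n, i + 2 ≤ n ∧ (γ.pt i).height + 1 ≤ (γ.pt n).height := by
    obtain ⟨n, hn⟩ := hγ (max (γ.pt i).height ((γ.pt 0).height + (i + 2)))
    have := (γ.height_le (Nat.zero_le n)).1
    exact ⟨n, by omega, by omega⟩
  classical
  obtain ⟨hn1, hn2⟩ := Nat.find_spec hex
  have hmin := fun m => Nat.find_min hex (m := m)
  set n := Nat.find hex
  have hlt : ∀ m, i + 2 ≤ m → m < n → (γ.pt m).height ≤ (γ.pt i).height := fun m hm hmn => by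
    have := hmin m hmn
    push Not at this
    have := this hm
    omega
  have hn3 : (γ.pt n).height = (γ.pt i).height + 1 := by
    have hne : n ≠ i + 2 := by
      intro h
      rw [h] at hn2
      omega
    have := hlt (n - 1) (by omega) (by omega)
    have := γ.height_succ (n - 1)
    rw [show n - 1 + 1 = n by omega] at this
    omega
  -- Let `h` be the height at time `i` and `m` the least height between times `i + 2` and `n`. The
  -- path needs `2` steps up and down, `h - m` down and `h + 1 - m` up again, while
  -- `sub_le_of_range` allows only `2 * (h + 1 - m) - 1`.
  obtain ⟨m₀, hm₀, hmin₀⟩ := Finset.exists_min_image (Finset.Icc (i + 2) n)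
    (fun m => (γ.pt m).height) ⟨n, Finset.mem_Icc.2 ⟨hn1, le_rfl⟩⟩
  rw [Finset.mem_Icc] at hm₀
  have h3 := hmin₀ (i + 2) (Finset.mem_Icc.2 ⟨le_rfl, hn1⟩)
  have h4 := γ.sub_le_of_range (i := i) (j := n) (by omega) (a := (γ.pt m₀).height)
    (b := (γ.pt i).height + 1) (by
      intro m him hmn
      rcases (show m = i ∨ m = i + 1 ∨ i + 2 ≤ m by omega) with rfl | rfl | hm
      · omega
      · omega
      · have := hmin₀ m (Finset.mem_Icc.2 ⟨hm, hmn⟩)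
        rcases hmn.lt_or_eq with h | rfl
        · have := hlt m hm h
          omega
        · omega)
  have h5 := (γ.height_le hm₀.1).2
  have h6 := (γ.height_le hm₀.2).1
  rw [hn3, show (γ.pt i).height - ((γ.pt i).height + 1) = -1 by ring] at h4
  norm_num at h4
  push_cast at h5
  omega

theorem eventually_up (hγ : ∀ c, ∃ n, c < (γ.pt n).height) :
    ∃ N, ∀ n ≥ N, (γ.pt (n + 1)).height = (γ.pt n).height + 1 := by
  obtain ⟨N, hN⟩ : ∃ N, (γ.pt (N + 1)).height = (γ.pt N).height + 1 := by
    by_contra! H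
    have : ∀ n, (γ.pt n).height ≤ (γ.pt 0).height := by
      intro n
      induction n with
      | zero => rfl
      | succ n ih => have := (γ.height_succ n).resolve_left (H n); omega
    obtain ⟨n, hn⟩ := hγ (γ.pt 0).height
    have := this n
    omega
  refine ⟨N, fun n hn => ?_⟩
  induction n, hn using Nat.le_induction with
  | base => exact hN
  | succ n hn ih => exact not_up_down hγ ih

variable (γ) in
/-- The ray eventually climbs along `canon ω`. -/
def ClimbsTo (ω : Set ℤ) : Prop := ∃ s : ℤ, ∀ᶠ n : ℕ in atTop, γ.pt n = canon ω (n + s)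

/-- From the time the ray only climbs, lamps below the lamplighter are never touched again; `ω` is
the set of these frozen lit lamps. -/
theorem exists_climbsTo (hγ : ∀ c, ∃ n, c < (γ.pt n).height) : ∃ ω, BddBelow ω ∧ γ.ClimbsTo ω := by
  obtain ⟨N, hN⟩ := eventually_up hγ
  have hh : ∀ n ≥ N, (γ.pt n).height = (γ.pt N).height + (n - N) := by
    intro n hn
    induction n, hn using Nat.le_induction with
    | base => simp
    | succ n hn ih => rw [hN n hn, ih]; push_cast; ring
  have hl : ∀ n n', N ≤ n → n ≤ n' → ∀ k, ¬ (k ∈ (γ.pt n).lamps ↔ k ∈ (γ.pt n').lamps) →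
      (γ.pt n).height ≤ k ∧ k < (γ.pt n').height := fun n n' hn hn' k hk =>
    γ.mem_lamps_of_range hn' (fun m h1 h2 => by
      rw [hh m (by omega), hh n hn, hh n' (by omega)]; omega) k hk
  have hω : BddBelow {k | ∃ n ≥ N, k < (γ.pt n).height ∧ k ∈ (γ.pt n).lamps} := by
    obtain ⟨c, hc⟩ := bddBelow_lamps (γ.pt N)
    refine ⟨min c (γ.pt N).height, ?_⟩
    rintro k ⟨n, hn, hk, hk'⟩
    by_contra hlt
    have h2 : k ∈ (γ.pt N).lamps := by
      by_contra h
      have := hl N n le_rfl hn k (by tauto)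
      omega
    have : c ≤ k := hc h2
    omega
  refine ⟨{k | ∃ n ≥ N, k < (γ.pt n).height ∧ k ∈ (γ.pt n).lamps}, hω,
    (γ.pt N).height - N, ?_⟩
  -- Lamps lit at time `N` above the lamplighter may persist until he has passed them. Beyond `C`
  -- nothing at or above his position is lit.
  obtain ⟨C, hC⟩ := (γ.pt N).lamps.bddAbove
  filter_upwards [eventually_ge_atTop N,
    (tendsto_intCast_add ((γ.pt N).height - N)).eventually_gt_atTop C] with n hn hnC
  have hhn := hh n hn
  ext k
  · rw [mem_canon hω]
    constructor
    · intro hk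
      have hkn : k < (γ.pt n).height := by
        by_contra hlt
        by_cases h : k ∈ (γ.pt N).lamps
        · have : k ≤ C := hC h
          omega
        · have := hl N n le_rfl hn k (by tauto)
          omega
      exact ⟨⟨n, hn, hkn, hk⟩, by omega⟩
    · rintro ⟨⟨n', hn', hk1, hk2⟩, hk3⟩
      by_contra hk4
      rcases le_total n n' with h | h
      · have := hl n n' hn h k (by tauto)
        omega
      · have := hl n' n hn' h k (by tauto)
        omega
  · rw [canon_height, hhn]
    ring

theorem ClimbsTo.tendsto_height {ω : Set ℤ} (h : γ.ClimbsTo ω) :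
    Tendsto (fun n => (γ.pt n).height) atTop atTop := by
  obtain ⟨s, hs⟩ := h
  exact (tendsto_intCast_add s).congr' (hs.mono fun n hn => by simp [hn])

end Ray

/-! ### Points of the upper visual boundary as configurations bounded below. -/

theorem wdist_canon {ω : Set ℤ} (hω : BddBelow ω) {a b : ℤ} (hab : a ≤ b) :
    (wdist (canon ω a) (canon ω b) : ℤ) = b - a := by
  have h1 := wdist_le_of_range (z := canon ω a) (x := canon ω b) (a := a) (b := b)
    (by simpa using hab) (by simpa using hab) fun k hk => by
      rw [mem_canon hω, mem_canon hω] at hk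
      by_contra h
      exact hk ⟨fun h' => ⟨h'.1, by omega⟩, fun h' => ⟨h'.1, by omega⟩⟩
  have h2 := wdist_eq (canon ω a) (canon ω b)
  obtain ⟨a1, -, -⟩ := le_tourMin_iff.1 (le_refl (tourMin (canon ω a) (canon ω b)))
  obtain ⟨-, b2, -⟩ := le_tourMin_reflect_iff.1
    (le_refl (tourMin (reflect (canon ω a)) (reflect (canon ω b))))
  rw [canon_height, canon_height, abs_of_nonpos (a := a - b) (by omega)] at h1 h2
  rw [canon_height] at a1 b2
  omega

theorem wdist_canon_abs {ω : Set ℤ} (hω : BddBelow ω) (a b : ℤ) :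
    (wdist (canon ω a) (canon ω b) : ℤ) = |b - a| := by
  rcases le_total a b with h | h
  · rw [wdist_canon hω h, abs_of_nonneg (by omega)]
  · rw [wdist_comm, wdist_canon hω h, abs_of_nonpos (by omega)]
    ring

/-- The ray climbing from height `0` along `canon ω`. -/
noncomputable def canonRay (ω : Set ℤ) (hω : BddBelow ω) : Ray where
  pt n := canon ω n
  isometric m n h := by
    have := wdist_canon hω (a := m) (b := n) (by omega)
    omega

/-- The point of the upper visual boundary with lamps `ω`. -/
noncomputable def upperPoint (ω : Set ℤ) (hω : BddBelow ω) : VisualBoundary :=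
  (canonRay ω hω).endpoint

theorem canonRay_climbsTo {ω : Set ℤ} (hω : BddBelow ω) : (canonRay ω hω).ClimbsTo ω :=
  ⟨0, Eventually.of_forall fun n => by simp [canonRay]⟩

theorem endpoint_eq_iff {γ δ : Ray} : γ.endpoint = δ.endpoint ↔ γ.Asymptotic δ := Quotient.eq

theorem Ray.ClimbsTo.endpoint_eq {γ : Ray} {ω : Set ℤ} (h : γ.ClimbsTo ω) (hω : BddBelow ω) :
    γ.endpoint = upperPoint ω hω := by
  rw [upperPoint, endpoint_eq_iff]
  obtain ⟨s, hs⟩ := h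
  obtain ⟨N, hN⟩ := eventually_atTop.1 hs
  -- The sum covers the finitely many times before both rays climb along `canon ω`; afterwards they
  -- differ by the time shift `s`.
  refine ⟨∑ n ∈ Finset.range N, wdist (γ.pt n) ((canonRay ω hω).pt n) + s.natAbs, fun n => ?_⟩
  rcases lt_or_ge n N with h | h
  · have := Finset.single_le_sum (f := fun n => wdist (γ.pt n) ((canonRay ω hω).pt n))
      (fun _ _ => Nat.zero_le _) (Finset.mem_range.2 h)
    omega
  · have h1 := wdist_canon_abs hω (n + s) n
    rw [hN n h]
    simp only [canonRay]
    rw [show (n : ℤ) - (n + s) = -s by ring, abs_neg, Int.abs_eq_natAbs] at h1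
    omega

theorem abs_height_sub_le (z x : LampGroup) : |z.height - x.height| ≤ wdist z x := by
  have h0 := wdist_eq z x
  obtain ⟨a1, a2, -⟩ := le_tourMin_iff.1 (le_refl (tourMin z x))
  obtain ⟨b1, b2, -⟩ := le_tourMin_reflect_iff.1 (le_refl (tourMin (reflect z) (reflect x)))
  rcases abs_cases (z.height - x.height) with h | h <;> omega

/-- A lamp `k` where the configurations differ forces every tour between the rays to return to `k`,
and this costs more and more as both climb. -/
theorem Ray.ClimbsTo.eq_of_asymptotic {γ δ : Ray} {ω ω' : Set ℤ} (h : γ.ClimbsTo ω)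
    (h' : δ.ClimbsTo ω') (hω : BddBelow ω) (hω' : BddBelow ω') (H : γ.Asymptotic δ) : ω = ω' := by
  obtain ⟨s, hs⟩ := h
  obtain ⟨s', hs'⟩ := h'
  obtain ⟨K, hK⟩ := H
  ext k
  by_contra hk
  obtain ⟨n, hn, hn', h1, h2⟩ := (hs.and (hs'.and
    (((tendsto_intCast_add s).eventually_gt_atTop (k + K)).and
      ((tendsto_intCast_add s').eventually_gt_atTop (k + K))))).exists
  have h3 := hK n
  rw [hn, hn'] at h3
  have h4 := wdist_eq (canon ω (n + s)) (canon ω' (n + s'))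
  obtain ⟨-, -, a3⟩ := le_tourMin_iff.1 (le_refl (tourMin (canon ω (n + s)) (canon ω' (n + s'))))
  obtain ⟨b1, b2, -⟩ := le_tourMin_reflect_iff.1
    (le_refl (tourMin (reflect (canon ω (n + s))) (reflect (canon ω' (n + s')))))
  have h5 := a3 k (by
    rw [mem_canon hω, mem_canon hω']
    have : k < n + s := by omega
    have : k < n + s' := by omega
    tauto)
  rw [canon_height] at b1 b2
  rw [canon_height, canon_height] at h4
  rcases abs_cases ((n : ℤ) + s - (n + s')) with h | h <;> omega

theorem exists_climbsTo_of_endpoint_eq {γ : Ray} {ω : Set ℤ} {hω : BddBelow ω}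
    (h : γ.endpoint = upperPoint ω hω) : γ.ClimbsTo ω := by
  have H := endpoint_eq_iff.1 h
  obtain ⟨ω', hω', h'⟩ := γ.exists_climbsTo (by
    intro c
    obtain ⟨K, hK⟩ := H
    -- Heights differ by at most the distance, so at time `n` the height of `γ` is at least `n - K`.
    refine ⟨(c + K + 1).toNat, ?_⟩
    have h1 := hK (c + K + 1).toNat
    have h2 := abs_height_sub_le (γ.pt (c + K + 1).toNat) ((canonRay ω hω).pt (c + K + 1).toNat)
    have h3 : ((canonRay ω hω).pt (c + K + 1).toNat).height = (c + K + 1).toNat := rfl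
    rw [h3] at h2
    have := abs_le.1 h2
    omega)
  rwa [h'.eq_of_asymptotic (canonRay_climbsTo hω) hω' hω H] at h'

theorem isBusemann_upperPoint {ω : Set ℤ} (hω : BddBelow ω) :
    IsBusemann (upperPoint ω hω) (busemann ω) := by
  intro γ hγ
  obtain ⟨s, hs⟩ := exists_climbsTo_of_endpoint_eq hγ
  exact tendsto_horoEmb_of_eventually_canon hω hs

theorem upperPoint_mem_visualPlus {ω : Set ℤ} (hω : BddBelow ω) : upperPoint ω hω ∈ visualPlus :=
  ⟨_, rfl, (canonRay_climbsTo hω).tendsto_height⟩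

theorem isBusemann_unique {ξ : VisualBoundary} {b b' : LampGroup → ℝ} (h : IsBusemann ξ b)
    (h' : IsBusemann ξ b') : b = b' := by
  obtain ⟨γ, rfl⟩ := Quotient.exists_rep ξ
  exact tendsto_nhds_unique (h γ rfl) (h' γ rfl)

theorem exists_eq_upperPoint {ξ : VisualBoundary} (h : ξ ∈ visualPlus) :
    ∃ ω hω, ξ = upperPoint ω hω := by
  obtain ⟨γ, rfl, hγ⟩ := h
  obtain ⟨ω, hω, h⟩ := γ.exists_climbsTo fun c => (hγ.eventually_gt_atTop c).exists
  exact ⟨ω, hω, h.endpoint_eq hω⟩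

theorem busemannPlus_eq : busemannPlus = upper := by
  ext b
  constructor
  · rintro ⟨ξ, hξ, hb⟩
    obtain ⟨ω, hω, rfl⟩ := exists_eq_upperPoint hξ
    exact ⟨ω, hω, isBusemann_unique hb (isBusemann_upperPoint hω)⟩
  · rintro ⟨ω, hω, rfl⟩
    exact ⟨_, upperPoint_mem_visualPlus hω, isBusemann_upperPoint hω⟩

theorem upperPoint_inj {ω ω' : Set ℤ} {hω : BddBelow ω} {hω' : BddBelow ω'} :
    upperPoint ω hω = upperPoint ω' hω' ↔ ω = ω' := by
  constructor
  · exact fun h => (canonRay_climbsTo hω).eq_of_asymptotic (canonRay_climbsTo hω') hω hω'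
      (endpoint_eq_iff.1 h)
  · rintro rfl
    rfl

theorem visualAct_upperPoint (g : LampGroup) {ω : Set ℤ} (hω : BddBelow ω) :
    visualAct g (upperPoint ω hω) = upperPoint (move g ω) (bddBelow_move g hω) := by
  refine Ray.ClimbsTo.endpoint_eq (γ := Ray.translate g (canonRay ω hω)) ⟨g.height, ?_⟩ _
  obtain ⟨C, hC⟩ := g.lamps.bddAbove
  filter_upwards [(tendsto_intCast_add g.height).eventually_gt_atTop C] with n hn
  ext k
  · rw [mem_canon (bddBelow_move g hω), mem_move]
    simp only [Ray.translate, canonRay, mul_lamps, Finset.mem_symmDiff, mem_vadd_finset_int,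
      mem_canon hω]
    by_cases hk : k < n + g.height
    · have : k - g.height < n := by omega
      tauto
    · have h1 : ¬ k - g.height < n := by omega
      have h2 : k ∉ g.lamps := fun h => by
        have : k ≤ C := hC h
        omega
      tauto
  · simp [Ray.translate, canonRay, add_comm]

/-! ### Invariance -/

theorem range_subset_horoCompactification : Set.range horoEmb ⊆ horoCompactification :=
  subset_closure

theorem act_inv_act (g : LampGroup) {h : LampGroup → ℝ} (hh : h ∈ horoCompactification) :
    act g⁻¹ (act g h) = h := by
  rw [← act_mul, inv_mul_cancel, act_one hh]

theorem act_image_eq {F : Set (LampGroup → ℝ)} (hF : F ⊆ horoCompactification)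
    (H : ∀ g, ∀ h ∈ F, act g h ∈ F) (g : LampGroup) : act g '' F = F := by
  refine Set.Subset.antisymm (Set.image_subset_iff.2 fun h hh => H g h hh) fun h hh => ?_
  exact ⟨_, H g⁻¹ h hh, by simpa using act_inv_act g⁻¹ (hF hh)⟩

theorem act_mem_upper (g : LampGroup) {h : LampGroup → ℝ} (hh : h ∈ upper) : act g h ∈ upper := by
  obtain ⟨ω, hω, rfl⟩ := hh
  exact ⟨_, bddBelow_move g hω, act_busemann g hω⟩

theorem upper_subset : upper ⊆ horoBoundary := by
  rintro _ ⟨ω, hω, rfl⟩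
  exact busemann_mem_horoBoundary hω

/-- Families of boundary points that are invariant under the action. -/
def IsInvariantFamily (F : Set (LampGroup → ℝ)) : Prop :=
  F ⊆ horoBoundary ∧ ∀ g, ∀ h ∈ F, act g h ∈ F

theorem IsInvariantFamily.pull {F : Set (LampGroup → ℝ)} (hF : IsInvariantFamily F) :
    IsInvariantFamily (pull '' F) := by
  refine ⟨?_, ?_⟩
  · rintro _ ⟨h, hh, rfl⟩
    exact pull_mem_horoBoundary.2 (hF.1 hh)
  · rintro g _ ⟨h, hh, rfl⟩
    exact ⟨_, hF.2 (reflect g) h hh, by rw [pull_act, reflect_reflect]⟩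

theorem isInvariantFamily_upper : IsInvariantFamily upper :=
  ⟨upper_subset, fun g _ => act_mem_upper g⟩

theorem isInvariantFamily_ribsPlus : IsInvariantFamily ribsPlus := by
  rw [ribsPlus_eq]
  refine ⟨?_, ?_⟩
  · rintro _ ⟨ω, l, hω, rfl⟩
    exact ribLimit_mem_horoBoundary hω l
  · rintro g _ ⟨ω, l, hω, rfl⟩
    exact ⟨_, _, bddBelow_move g hω, act_ribLimit g hω l⟩

theorem isInvariantFamily_spine : IsInvariantFamily spine := by
  refine ⟨?_, ?_⟩
  · rintro _ ⟨l, rfl⟩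
    exact spineFun_mem_horoBoundary l
  · rintro g _ ⟨l, rfl⟩
    exact ⟨_, (act_spineFun g l).symm⟩

theorem isInvariantFamily_heightFun : IsInvariantFamily {heightFun} := by
  refine ⟨by simpa using heightFun_mem_horoBoundary, ?_⟩
  rintro g _ rfl
  exact act_heightFun g

/-! ### Reflection of the visual boundary -/

/-- The reflection of a ray. -/
def Ray.reflect (γ : Ray) : Ray where
  pt n := LampGroup.reflect (γ.pt n)
  isometric m n h := by rw [wdist_reflect, γ.isometric m n h]

theorem Ray.reflect_reflect (γ : Ray) : γ.reflect.reflect = γ := by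
  cases γ
  simp [Ray.reflect]

/-- The reflection of the visual boundary. -/
def visualReflect : VisualBoundary → VisualBoundary :=
  Quotient.map Ray.reflect fun _ _ ⟨K, hK⟩ => ⟨K, fun n => (wdist_reflect _ _).le.trans (hK n)⟩

theorem visualReflect_endpoint (γ : Ray) : visualReflect γ.endpoint = γ.reflect.endpoint := rfl

theorem visualReflect_visualReflect (ξ : VisualBoundary) : visualReflect (visualReflect ξ) = ξ := by
  obtain ⟨γ, rfl⟩ := Quotient.exists_rep ξ
  change γ.reflect.reflect.endpoint = γ.endpoint
  rw [γ.reflect_reflect]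

theorem visualAct_visualReflect (g : LampGroup) (ξ : VisualBoundary) :
    visualAct g (visualReflect ξ) = visualReflect (visualAct (reflect g) ξ) := by
  obtain ⟨γ, rfl⟩ := Quotient.exists_rep ξ
  change (Ray.translate g γ.reflect).endpoint = (Ray.translate (reflect g) γ).reflect.endpoint
  congr 1
  simp [Ray.translate, Ray.reflect, reflect_mul]

theorem IsBusemann.reflect {ξ : VisualBoundary} {b : LampGroup → ℝ} (h : IsBusemann ξ b) :
    IsBusemann (visualReflect ξ) (pull b) := by
  intro γ hγ
  have h1 := h γ.reflect (by
    rw [← visualReflect_endpoint, hγ, visualReflect_visualReflect])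
  have h2 := (continuous_pull.tendsto b).comp h1
  simpa only [Function.comp_def, pull_horoEmb, Ray.reflect, LampGroup.reflect_reflect] using h2

theorem visualReflect_mem_visualMinus {ξ : VisualBoundary} :
    visualReflect ξ ∈ visualMinus ↔ ξ ∈ visualPlus := by
  constructor
  · rintro ⟨γ, hγ, h⟩
    refine ⟨γ.reflect, by rw [← visualReflect_endpoint, hγ, visualReflect_visualReflect], ?_⟩
    exact tendsto_neg_atBot_atTop.comp h
  · rintro ⟨γ, rfl, h⟩
    exact ⟨γ.reflect, rfl, tendsto_neg_atTop_atBot.comp h⟩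

theorem busemannMinus_eq : busemannMinus = pull '' upper := by
  rw [← busemannPlus_eq]
  ext b
  constructor
  · rintro ⟨ξ, hξ, hb⟩
    refine ⟨_, ⟨visualReflect ξ, ?_, hb.reflect⟩, pull_pull b⟩
    rwa [← visualReflect_mem_visualMinus, visualReflect_visualReflect]
  · rintro ⟨_, ⟨ξ, hξ, hb⟩, rfl⟩
    exact ⟨_, visualReflect_mem_visualMinus.2 hξ, hb.reflect⟩

theorem mem_visualPlus_or (ξ : VisualBoundary) : ξ ∈ visualPlus ∨ visualReflect ξ ∈ visualPlus := by
  obtain ⟨γ, rfl⟩ := Quotient.exists_rep ξ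
  rcases γ.unbounded with h | h
  · obtain ⟨ω, -, hω⟩ := Ray.exists_climbsTo h
    exact Or.inl ⟨γ, rfl, hω.tendsto_height⟩
  · obtain ⟨ω, -, hω⟩ := Ray.exists_climbsTo (γ := γ.reflect) fun c => by
      obtain ⟨n, hn⟩ := h (-c)
      exact ⟨n, by change c < -(γ.pt n).height; omega⟩
    exact Or.inr ⟨γ.reflect, rfl, hω.tendsto_height⟩

theorem isInvariantFamily_of_mem {F : Set (LampGroup → ℝ)} (hF : F ∈ boundaryFamilies) :
    IsInvariantFamily F := by
  rcases hF with rfl | rfl | rfl | rfl | rfl | rfl | rfl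
  · rw [busemannPlus_eq]; exact isInvariantFamily_upper
  · rw [busemannMinus_eq]; exact isInvariantFamily_upper.pull
  · exact isInvariantFamily_spine
  · exact isInvariantFamily_ribsPlus
  · rw [ribsMinus_eq]; exact isInvariantFamily_ribsPlus.pull
  · exact isInvariantFamily_heightFun
  · have := isInvariantFamily_heightFun.pull
    rwa [Set.image_singleton, pull_heightFun] at this

theorem isInvariantFamily_upper_union : IsInvariantFamily (upper ∪ {heightFun}) :=
  ⟨Set.union_subset upper_subset isInvariantFamily_heightFun.1, fun g h hh => hh.imp
    (isInvariantFamily_upper.2 g h) (isInvariantFamily_heightFun.2 g h)⟩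

/-! ### Fixed sets of lamps -/

theorem move_inv_eq_iff {g : LampGroup} {ω : Set ℤ} : move g⁻¹ ω = ω ↔ move g ω = ω := by
  constructor <;> intro h
  · conv_lhs => rw [← h]
    rw [← move_mul, mul_inv_cancel, move_one]
  · conv_lhs => rw [← h]
    rw [← move_mul, inv_mul_cancel, move_one]

/-- `move g` is affine over `ℤ/2`: in the difference of two configurations the lamps of `g` cancel
and only the translation remains. -/
theorem mem_move_iff_of_fixed {g : LampGroup} {ω₀ : Set ℤ} (h : move g ω₀ = ω₀) (ω : Set ℤ) (j : ℤ) :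
    (j ∈ move g ω ↔ j ∈ ω₀) ↔ (j - g.height ∈ ω ↔ j - g.height ∈ ω₀) := by
  have : j ∈ ω₀ ↔ j ∈ move g ω₀ := by rw [h]
  rw [this, mem_move, mem_move]
  tauto

theorem move_pow_fixed {g : LampGroup} {ω : Set ℤ} (h : move g ω = ω) (n : ℕ) :
    move (g ^ n) ω = ω := by
  induction n with
  | zero => rw [pow_zero, move_one]
  | succ n ih => rw [pow_succ, move_mul, h, ih]

theorem pow_height (g : LampGroup) (n : ℕ) : (g ^ n).height = n * g.height := by
  induction n with
  | zero => simp
  | succ n ih => rw [pow_succ, mul_height, ih]; push_cast; ring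

theorem fixed_unique {g : LampGroup} (hg : 0 < g.height) {ω ω' : Set ℤ} (hω : BddBelow ω)
    (hω' : BddBelow ω') (h : move g ω = ω) (h' : move g ω' = ω') : ω' = ω := by
  ext j
  by_contra hj
  obtain ⟨c, hc⟩ := hω
  obtain ⟨c', hc'⟩ := hω'
  -- For this `n`, the point `j - n * g.height` lies below both lower bounds, where both
  -- configurations are empty and so agree.
  obtain ⟨n, hn⟩ : ∃ n : ℕ, j - c' < n ∧ j - c < n :=
    ⟨(max (j - c') (j - c) + 1).toNat, by omega, by omega⟩
  have h1 := mem_move_iff_of_fixed (move_pow_fixed h n) ω' j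
  rw [move_pow_fixed h' n, pow_height] at h1
  have h2 : (n : ℤ) ≤ n * g.height := by nlinarith
  refine hj (h1.2 ⟨fun H => ?_, fun H => ?_⟩)
  · have : c' ≤ _ := hc' H
    omega
  · have : c ≤ _ := hc H
    omega

/-- Unrolling the fixed-point equation from `-∞` upwards shows that `j` is lit exactly when an odd
number of lamps of `g` lie at or below `j` in its residue class modulo the height of `g`; `S j` is
the set of these lamps. -/
theorem exists_fixed_of_pos {g : LampGroup} (hg : 0 < g.height) :
    ∃ ω, BddBelow ω ∧ move g ω = ω := by
  let S : ℤ → Finset ℤ := fun j => g.lamps.filter fun i => i ≤ j ∧ g.height ∣ j - i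
  have hdvd : ∀ i j, g.height ∣ j - g.height - i ↔ g.height ∣ j - i := fun i j => by
    rw [show j - g.height - i = j - i - g.height by ring, dvd_sub_self_right]
  have hle : ∀ i j, i ≠ j → g.height ∣ j - i → (i ≤ j - g.height ↔ i ≤ j) := fun i j hij hd => by
    refine ⟨fun h => by omega, fun h => ?_⟩
    have := Int.le_of_dvd (by omega) hd
    omega
  have hS : ∀ j, S j = if j ∈ g.lamps then insert j (S (j - g.height)) else S (j - g.height) := by
    intro j
    ext i
    by_cases hij : i = j
    · subst hij
      split_ifs with h
      · simp [S, h]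
      · simp [S, h]
    · have h1 := hle i j hij
      have h2 := hdvd i j
      split_ifs with h <;> simp only [S, Finset.mem_insert, Finset.mem_filter] <;> tauto
  have hnot : ∀ j, j ∉ S (j - g.height) := fun j h => by
    have := (Finset.mem_filter.1 h).2.1
    omega
  refine ⟨{j | Odd (S j).card}, ?_, ?_⟩
  · obtain ⟨c, hc⟩ := bddBelow_lamps g
    refine ⟨c, fun j hj => ?_⟩
    obtain ⟨i, hi⟩ := Finset.card_pos.1 (Odd.pos hj)
    obtain ⟨h1, h2, -⟩ := Finset.mem_filter.1 hi
    exact le_trans (hc h1) h2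
  · ext j
    rw [mem_move, Set.mem_ofPred_eq, Set.mem_ofPred_eq, hS j]
    split_ifs with h
    · rw [Finset.card_insert_of_notMem (hnot j), Nat.odd_add_one]
      tauto
    · tauto

theorem exists_unique_fixed {g : LampGroup} (hg : g.height ≠ 0) :
    ∃ ω, BddBelow ω ∧ move g ω = ω ∧ ∀ ω', BddBelow ω' → move g ω' = ω' → ω' = ω := by
  rcases hg.lt_or_gt with h | h
  · have h' : 0 < g⁻¹.height := by rw [inv_height]; omega
    obtain ⟨ω, hω, hf⟩ := exists_fixed_of_pos h'
    exact ⟨ω, hω, move_inv_eq_iff.1 hf, fun ω' hω' hf' =>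
      fixed_unique h' hω hω' hf (move_inv_eq_iff.2 hf')⟩
  · obtain ⟨ω, hω, hf⟩ := exists_fixed_of_pos h
    exact ⟨ω, hω, hf, fun ω' hω' hf' => fixed_unique h hω hω' hf hf'⟩

/-! ### Fixed points -/

theorem spineFun_injective {l l' : ℤ} (h : spineFun l = spineFun l') : l = l' := by
  have h1 := congrFun h ⟨∅, l⟩
  have h2 := congrFun h ⟨∅, l'⟩
  simp only [spineFun, Int.cast_inj, sub_self, abs_zero, sub_zero] at h1 h2
  rw [abs_sub_comm] at h1
  have h3 : |l - l'| = 0 := by omega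
  have := abs_eq_zero.1 h3
  omega

theorem ribLimit_singleton {ω : Set ℤ} {c l n : ℤ} (hω : ∀ k ∈ ω, c < k) (hl : c ≤ l) (hn : c ≤ n) :
    ribLimit ω l ⟨{c}, n⟩ = ((2 * (lo ω (min l 0) - c) + (|l| - |l - n|) : ℤ) : ℝ) := by
  have hbdd : BddBelow (ω ∆ (({c} : Finset ℤ) : Set ℤ)) :=
    bddBelow_symmDiff ⟨c, fun k hk => (hω k hk).le⟩ ({c} : Finset ℤ).bddBelow
  have h : lo (ω ∆ (({c} : Finset ℤ) : Set ℤ)) (min l n) = c := by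
    refine le_antisymm (lo_le_of_mem hbdd ?_) ((le_lo_iff hbdd).2 ⟨by omega, fun k hk => ?_⟩)
    · rw [Set.mem_symmDiff]
      exact Or.inr ⟨by simp, fun h => (hω c h).false⟩
    · rcases Set.mem_symmDiff.1 hk with ⟨h, -⟩ | ⟨h, -⟩
      · exact (hω k h).le
      · rw [Finset.coe_singleton, Set.mem_singleton_iff] at h
        omega
  simp only [ribLimit, spineFun, h]
  push_cast
  ring

/-- A lamp lit below everything else fixes the lower end of the tour. On such lamp stands a rib
function is a spine function up to a constant, and its maximum over the heights `n ≥ c` is at `l`.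
-/
theorem ribLimit_height_injective {ω ω' : Set ℤ} {l l' : ℤ} (hω : BddBelow ω) (hω' : BddBelow ω')
    (h : ribLimit ω l = ribLimit ω' l') : l = l' := by
  obtain ⟨a, ha⟩ := hω
  obtain ⟨b, hb⟩ := hω'
  obtain ⟨c, h1, h2, h3, h4⟩ : ∃ c, c < a ∧ c < b ∧ c ≤ l ∧ c ≤ l' :=
    ⟨min (min (a - 1) (b - 1)) (min l l'), by omega, by omega, by omega, by omega⟩
  have hωc : ∀ k ∈ ω, c < k := fun k hk => h1.trans_le (ha hk)
  have hωc' : ∀ k ∈ ω', c < k := fun k hk => h2.trans_le (hb hk)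
  have e1 := congrFun h ⟨{c}, l⟩
  have e2 := congrFun h ⟨{c}, l'⟩
  rw [ribLimit_singleton hωc h3 (by omega), ribLimit_singleton hωc' h4 (by omega),
    Int.cast_inj] at e1 e2
  rw [sub_self, abs_zero] at e1 e2
  rw [abs_sub_comm l' l] at e1
  have h3 : |l - l'| = 0 := by omega
  have := abs_eq_zero.1 h3
  omega

theorem act_ne_self_of_mem_ribsPlus {g : LampGroup} (hg : g.height ≠ 0) {h : LampGroup → ℝ}
    (hh : h ∈ ribsPlus) : act g h ≠ h := by
  rw [ribsPlus_eq] at hh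
  obtain ⟨ω, l, hω, rfl⟩ := hh
  rw [act_ribLimit g hω]
  intro H
  have := ribLimit_height_injective (bddBelow_move g hω) hω H
  omega

theorem act_pull_eq_iff {g : LampGroup} {h : LampGroup → ℝ} :
    act (reflect g) (pull h) = pull h ↔ act g h = h := by
  rw [← pull_act, pull_injective.eq_iff]

theorem setOf_fixed_eq {g : LampGroup} (hg : g.height ≠ 0) {ω ω' : Set ℤ} (hω : BddBelow ω)
    (hω' : BddBelow ω') (hf : move g ω = ω) (hu : ∀ η, BddBelow η → move g η = η → η = ω)
    (hf' : move (reflect g) ω' = ω')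
    (hu' : ∀ η, BddBelow η → move (reflect g) η = η → η = ω') :
    {h ∈ horoBoundary | act g h = h} =
      {heightFun, -heightFun, busemann ω, pull (busemann ω')} := by
  ext h
  simp only [Set.mem_ofPred_eq, Set.mem_insert_iff, Set.mem_singleton_iff]
  constructor
  · rintro ⟨hh, hfix⟩
    have hfix' := act_pull_eq_iff.2 hfix
    rcases horoBoundary_classification hh with
      ⟨η, hη, rfl⟩ | ⟨η, hη, hp⟩ | ⟨l, rfl⟩ | hr | hr | rfl | rfl
    · rw [act_busemann g hη] at hfix
      have := hu η hη (busemann_injective (bddBelow_move g hη) hη hfix)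
      rw [this]
      tauto
    · rw [hp, act_busemann _ hη] at hfix'
      have := hu' η hη (busemann_injective (bddBelow_move _ hη) hη hfix')
      rw [← this, ← hp, pull_pull]
      tauto
    · rw [act_spineFun] at hfix
      have := spineFun_injective hfix
      omega
    · exact absurd hfix (act_ne_self_of_mem_ribsPlus hg hr)
    · exact absurd hfix' (act_ne_self_of_mem_ribsPlus (by rw [reflect_height]; omega) hr)
    · tauto
    · tauto
  · rintro (rfl | rfl | rfl | rfl)
    · exact ⟨heightFun_mem_horoBoundary, act_heightFun g⟩
    · exact ⟨neg_heightFun_mem_horoBoundary, act_neg_heightFun g⟩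
    · exact ⟨busemann_mem_horoBoundary hω, by rw [act_busemann g hω, hf]⟩
    · refine ⟨pull_mem_horoBoundary.2 (busemann_mem_horoBoundary hω'), act_pull_eq_iff.1 ?_⟩
      rw [pull_pull, act_busemann _ hω', hf']

theorem setOf_visual_fixed_eq {g : LampGroup} {ω ω' : Set ℤ} (hω : BddBelow ω)
    (hω' : BddBelow ω') (hf : move g ω = ω) (hu : ∀ η, BddBelow η → move g η = η → η = ω)
    (hf' : move (reflect g) ω' = ω')
    (hu' : ∀ η, BddBelow η → move (reflect g) η = η → η = ω') :
    {ξ | visualAct g ξ = ξ} = {upperPoint ω hω, visualReflect (upperPoint ω' hω')} := by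
  ext ξ
  simp only [Set.mem_ofPred_eq, Set.mem_insert_iff, Set.mem_singleton_iff]
  constructor
  · intro h
    rcases mem_visualPlus_or ξ with hξ | hξ
    · obtain ⟨η, hη, rfl⟩ := exists_eq_upperPoint hξ
      rw [visualAct_upperPoint, upperPoint_inj] at h
      exact Or.inl (upperPoint_inj.2 (hu η hη h))
    · obtain ⟨η, hη, he⟩ := exists_eq_upperPoint hξ
      have he' : ξ = visualReflect (upperPoint η hη) := by rw [← he, visualReflect_visualReflect]
      subst he'
      rw [visualAct_visualReflect] at h
      have h2 := congrArg visualReflect h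
      rw [visualReflect_visualReflect, visualReflect_visualReflect, visualAct_upperPoint,
        upperPoint_inj] at h2
      exact Or.inr (congrArg visualReflect (upperPoint_inj.2 (hu' η hη h2)))
  · rintro (rfl | rfl)
    · rw [visualAct_upperPoint, upperPoint_inj, hf]
    · rw [visualAct_visualReflect, visualAct_upperPoint]
      exact congrArg visualReflect (upperPoint_inj.2 hf')

/-! ### Distinctness of the four fixed points. -/

theorem heightFun_ne_neg : heightFun ≠ -heightFun := by
  intro h
  have := congrFun h step
  norm_num [heightFun, step] at this

/-- Along `canon ω` the height tends to `+∞` and `busemann ω` to `-∞`, so no bound of the form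
`height - C` lies below `busemann ω`. -/
theorem busemann_ne_of_le {ω : Set ℤ} (hω : BddBelow ω) {h : LampGroup → ℝ} (C : ℤ)
    (H : ∀ x, ((x.height - C : ℤ) : ℝ) ≤ h x) : busemann ω ≠ h := by
  rintro rfl
  have := H (canon ω (C.natAbs + (lo ω 0).natAbs + 1))
  rw [busemann_canon hω, Int.cast_le, canon_height] at this
  omega

theorem busemann_ne_heightFun {ω : Set ℤ} (hω : BddBelow ω) : busemann ω ≠ heightFun :=
  busemann_ne_of_le hω 0 fun x => by simp [heightFun]

theorem busemann_ne_neg_heightFun {ω : Set ℤ} (hω : BddBelow ω) : busemann ω ≠ -heightFun := by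
  intro h
  obtain ⟨c, hc⟩ := id hω
  -- A single lamp this far down at height `0` makes `busemann ω` positive, while `-H` vanishes.
  obtain ⟨d, hd⟩ : ∃ d, d = min (c - 1) (lo ω 0 - 1) := ⟨_, rfl⟩
  have h1 := congrFun h ⟨{d}, 0⟩
  have hdω : d ∉ ω := fun h => by
    have : c ≤ d := hc h
    omega
  have h2 : lo (ω ∆ (({d} : Finset ℤ) : Set ℤ)) 0 ≤ d :=
    lo_le_of_mem (bddBelow_symmDiff hω ({d} : Finset ℤ).bddBelow)
      (Set.mem_symmDiff.2 (Or.inr ⟨by simp, hdω⟩))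
  have h3 : (-heightFun) ⟨{d}, 0⟩ = ((0 : ℤ) : ℝ) := by simp [heightFun]
  rw [h3, busemann, Int.cast_inj] at h1
  dsimp only at h1
  omega

theorem busemann_ne_pull {ω ω' : Set ℤ} (hω : BddBelow ω) (hω' : BddBelow ω') :
    busemann ω ≠ pull (busemann ω') := by
  refine busemann_ne_of_le hω (-2 * lo ω' 0) fun x => ?_
  rw [pull, busemann, Int.cast_le, reflect_height]
  have := lo_le (bddBelow_symmDiff hω' (bddBelow_lamps (reflect x))) (-x.height)
  omega

theorem ncard_fixed {ω ω' : Set ℤ} (hω : BddBelow ω) (hω' : BddBelow ω') :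
    ({heightFun, -heightFun, busemann ω, pull (busemann ω')} : Set (LampGroup → ℝ)).ncard = 4 := by
  have h1 := busemann_ne_heightFun hω
  have h2 := busemann_ne_neg_heightFun hω
  have h3 : pull (busemann ω') ≠ -heightFun := by
    rw [← pull_heightFun]
    exact pull_injective.ne (busemann_ne_heightFun hω')
  have h4 : pull (busemann ω') ≠ heightFun := by
    rw [← pull_neg_heightFun]
    exact pull_injective.ne (busemann_ne_neg_heightFun hω')
  have h5 := busemann_ne_pull hω hω'
  rw [Set.ncard_insert_of_notMem, Set.ncard_insert_of_notMem, Set.ncard_pair h5]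
  · simp [h2.symm, h3.symm]
  · simp [heightFun_ne_neg, h1.symm, h4.symm]

/-! ### North-south dynamics -/

theorem exists_finite_of_mem_nhdsWithin {X V : Set (LampGroup → ℝ)} {p : LampGroup → ℝ}
    (hV : V ∈ 𝓝[X] p) : ∃ E : Set LampGroup, E.Finite ∧ ∀ h ∈ X, (∀ x ∈ E, h x = p x) → h ∈ V := by
  obtain ⟨W, hW, hWV⟩ := mem_nhdsWithin_iff_exists_mem_nhds_inter.1 hV
  rw [nhds_pi, Filter.mem_pi] at hW
  obtain ⟨E, hE, t, ht, hsub⟩ := hW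
  refine ⟨E, hE, fun h hX hh => hWV ⟨hsub fun x hx => ?_, hX⟩⟩
  rw [hh x hx]
  exact mem_of_mem_nhds (ht x)

theorem busemann_eq_height {ω : Set ℤ} (hω : BddBelow ω) {x : LampGroup} {c : ℤ} (hc0 : c ≤ 0)
    (hch : c ≤ x.height) (hcl : ∀ k ∈ x.lamps, c ≤ k) (h : ∃ k ∈ ω, k < c) :
    busemann ω x = heightFun x := by
  obtain ⟨k, hk, hkc⟩ := h
  have hkx : k ∉ x.lamps := fun h => by have := hcl k h; omega
  have : lo ω 0 = lo (ω ∆ x.lamps) x.height := by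
    refine lo_eq_of_le_iff hω (bddBelow_symmDiff hω (bddBelow_lamps x)) fun d => ?_
    simp only [Set.mem_symmDiff, Finset.mem_coe]
    constructor
    · rintro ⟨h1, h2⟩
      have := h2 k hk
      refine ⟨by omega, fun j hj => ?_⟩
      rcases hj with hj | hj
      · exact h2 j hj.1
      · have := hcl j hj.1
        omega
    · rintro ⟨h1, h2⟩
      have := h2 k (Or.inl ⟨hk, hkx⟩)
      refine ⟨by omega, fun j hj => ?_⟩
      by_cases hjx : j ∈ x.lamps
      · have := hcl j hjx
        omega
      · exact h2 j (Or.inl ⟨hj, hjx⟩)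
  rw [busemann, this, heightFun]
  simp

/-- A neighbourhood tests finitely many `x`, and a lamp of `ω` lit below all of them makes `busemann
ω` equal to `H` there. -/
theorem busemann_mem_nhds_heightFun {X V : Set (LampGroup → ℝ)} (hX : upper ⊆ X)
    (hV : V ∈ 𝓝[X] heightFun) :
    ∃ c : ℤ, ∀ ω, BddBelow ω → (∃ k ∈ ω, k < c) → busemann ω ∈ V := by
  obtain ⟨E, hE, H⟩ := exists_finite_of_mem_nhdsWithin hV
  choose c hc0 hch hcl using exists_lower_bound
  obtain ⟨a, ha⟩ := (hE.image c).bddBelow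
  refine ⟨a, fun ω hω h => H _ (hX ⟨ω, hω, rfl⟩) fun x hx => ?_⟩
  refine busemann_eq_height hω (hc0 x) (hch x) (hcl x) ?_
  obtain ⟨k, hk, hka⟩ := h
  exact ⟨k, hk, hka.trans_le (ha ⟨x, hx, rfl⟩)⟩

theorem busemann_mem_nhds_busemann {X U : Set (LampGroup → ℝ)} (hX : upper ⊆ X) {ω₀ : Set ℤ}
    (hω₀ : BddBelow ω₀) (hU : U ∈ 𝓝[X] (busemann ω₀)) :
    ∃ c : ℤ, ∀ ω, BddBelow ω → (∀ k < c, k ∈ ω ↔ k ∈ ω₀) → busemann ω ∈ U := by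
  obtain ⟨E, hE, H⟩ := exists_finite_of_mem_nhdsWithin hU
  obtain ⟨a, ha⟩ := (hE.image height).bddAbove
  refine ⟨max a 0, fun ω hω h => H _ (hX ⟨ω, hω, rfl⟩) fun x hx => ?_⟩
  have hxa : x.height ≤ a := ha ⟨x, hx, rfl⟩
  have h1 := lo_symmDiff_congr hω hω₀ x (i := x.height) fun k hk => h k (by omega)
  have h2 := lo_symmDiff_congr hω hω₀ 1 (i := 0) fun k hk => h k (by omega)
  rw [symmDiff_one_lamps, symmDiff_one_lamps] at h2
  rw [busemann, busemann, h1, h2]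

theorem northSouthOn_upper {g : LampGroup} (hg : 0 < g.height) {ω₀ : Set ℤ} (hω₀ : BddBelow ω₀)
    (hf : move g ω₀ = ω₀) :
    NorthSouthOn g (upper ∪ {heightFun}) (busemann ω₀) heightFun where
  invariant := act_image_eq (fun h hh => (isInvariantFamily_upper_union.1 hh).1)
    isInvariantFamily_upper_union.2 g
  attractor_mem := Or.inl ⟨ω₀, hω₀, rfl⟩
  repeller_mem := Or.inr rfl
  poles_ne := busemann_ne_heightFun hω₀
  attractor_fixed := by rw [act_busemann g hω₀, hf]
  repeller_fixed := act_heightFun g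
  attracts := by
    intro U hU V hV
    obtain ⟨a, ha⟩ := busemann_mem_nhds_busemann Set.subset_union_left hω₀ hU
    obtain ⟨b, hb⟩ := busemann_mem_nhds_heightFun Set.subset_union_left hV
    obtain ⟨c, hc⟩ := id hω₀
    filter_upwards [eventually_ge_atTop (max (a - b) (a - c)).toNat] with n hn
    rintro h ⟨⟨ω, hω, rfl⟩ | rfl, hhV⟩
    · rw [act_busemann _ hω]
      refine ha _ (bddBelow_move _ hω) fun k hk => ?_
      rw [mem_move_iff_of_fixed (move_pow_fixed hf n), pow_height]
      have hk' : k - n * g.height < b ∧ k - n * g.height < c := by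
        have : (n : ℤ) ≤ n * g.height := by nlinarith
        omega
      -- Outside `V` no lamp of `ω` is lit below `b`, and none of `ω₀` below `c`. The two thus agree
      -- far down, and `g ^ n` carries this agreement up past `a`.
      have h1 : k - n * g.height ∉ ω := fun h => hhV (hb ω hω ⟨_, h, hk'.1⟩)
      have h2 : k - n * g.height ∉ ω₀ := fun h => by
        have : c ≤ k - n * g.height := hc h
        omega
      tauto
    · have : heightFun ∈ V := mem_of_mem_nhdsWithin (Or.inr rfl) hV
      exact absurd this hhV
  repels := by
    intro U hU V hV
    obtain ⟨a, ha⟩ := busemann_mem_nhds_busemann Set.subset_union_left hω₀ hU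
    obtain ⟨b, hb⟩ := busemann_mem_nhds_heightFun Set.subset_union_left hV
    obtain ⟨c, hc⟩ := id hω₀
    filter_upwards [eventually_ge_atTop (max (a - b) (a - c)).toNat] with n hn
    rintro h ⟨⟨ω, hω, rfl⟩ | rfl, hhU⟩
    · rw [act_busemann _ hω]
      -- Outside `U` there is a disagreement below `a`. The power `g⁻¹ ^ n` carries it below `c`,
      -- where `ω₀` is empty, so it is a lit lamp; it also lies below `b`.
      obtain ⟨k, hka, hk⟩ : ∃ k < a, ¬ (k ∈ ω ↔ k ∈ ω₀) := by
        by_contra! H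
        exact hhU (ha ω hω H)
      refine hb _ (bddBelow_move _ hω) ⟨k - n * g.height, ?_, ?_⟩
      · have h1 := mem_move_iff_of_fixed (move_pow_fixed (move_inv_eq_iff.2 hf) n) ω
          (k - n * g.height)
        rw [pow_height, inv_height, show k - n * g.height - n * -g.height = k by ring] at h1
        have h2 : k - n * g.height ∉ ω₀ := fun h => by
          have h3 : c ≤ k - n * g.height := hc h
          have : (n : ℤ) ≤ n * g.height := by nlinarith
          omega
        by_contra h3
        exact hk (h1.1 ⟨fun h => absurd h h3, fun h => absurd h h2⟩)
      · have : (n : ℤ) ≤ n * g.height := by nlinarith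
        omega
    · rw [act_heightFun]
      exact mem_of_mem_nhdsWithin (Or.inr rfl) hV

theorem NorthSouthOn.inv {g : LampGroup} {X : Set (LampGroup → ℝ)} {p r : LampGroup → ℝ}
    (H : NorthSouthOn g X p r) (hX : X ⊆ horoCompactification) : NorthSouthOn g⁻¹ X r p where
  invariant := by
    conv_lhs => rw [← H.invariant]
    rw [Set.image_image]
    exact (Set.image_congr fun h hh => act_inv_act g (hX hh)).trans (Set.image_id' X)
  attractor_mem := H.repeller_mem
  repeller_mem := H.attractor_mem
  poles_ne := H.poles_ne.symm
  attractor_fixed := by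
    conv_lhs => rw [← H.repeller_fixed]
    exact act_inv_act g (hX H.repeller_mem)
  repeller_fixed := by
    conv_lhs => rw [← H.attractor_fixed]
    exact act_inv_act g (hX H.attractor_mem)
  attracts U hU V hV := H.repels V hV U hU
  repels U hU V hV := by
    rw [inv_inv]
    exact H.attracts V hV U hU

theorem NorthSouthOn.pull {g : LampGroup} {X : Set (LampGroup → ℝ)} {p r : LampGroup → ℝ}
    (H : NorthSouthOn g X p r) : NorthSouthOn (reflect g) (LampGroup.pull '' X) (LampGroup.pull p)
      (LampGroup.pull r) := by
  have hn : ∀ {U : Set (LampGroup → ℝ)} {q}, U ∈ 𝓝[LampGroup.pull '' X] (LampGroup.pull q) →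
      LampGroup.pull ⁻¹' U ∈ 𝓝[X] q := fun hU =>
    continuous_pull.continuousWithinAt.tendsto_nhdsWithin (Set.mapsTo_image _ _) hU
  refine ⟨?_, ⟨p, H.attractor_mem, rfl⟩, ⟨r, H.repeller_mem, rfl⟩, pull_injective.ne H.poles_ne,
    act_pull_eq_iff.2 H.attractor_fixed, act_pull_eq_iff.2 H.repeller_fixed, ?_, ?_⟩
  · conv_rhs => rw [← H.invariant]
    simp only [Set.image_image, pull_act]
  · intro U hU V hV
    filter_upwards [H.attracts _ (hn hU) _ (hn hV)] with n h
    rintro _ ⟨⟨k, hk, rfl⟩, hkV⟩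
    rw [← reflect_pow, ← pull_act]
    exact h k ⟨hk, hkV⟩
  · intro U hU V hV
    filter_upwards [H.repels _ (hn hU) _ (hn hV)] with n h
    rintro _ ⟨⟨k, hk, rfl⟩, hkV⟩
    rw [← reflect_inv, ← reflect_pow, ← pull_act]
    exact h k ⟨hk, hkV⟩

theorem northSouthOn_upper_of_neg {g : LampGroup} (hg : g.height < 0) {ω₀ : Set ℤ}
    (hω₀ : BddBelow ω₀) (hf : move g ω₀ = ω₀) :
    NorthSouthOn g (upper ∪ {heightFun}) heightFun (busemann ω₀) := by
  have := (northSouthOn_upper (g := g⁻¹) (by rw [inv_height]; omega) hω₀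
    (move_inv_eq_iff.2 hf)).inv fun h hh => (isInvariantFamily_upper_union.1 hh).1
  rwa [inv_inv] at this

theorem pull_image_upper_union :
    pull '' (upper ∪ {heightFun}) = busemannMinus ∪ {-heightFun} := by
  rw [Set.image_union, Set.image_singleton, pull_heightFun, busemannMinus_eq]

theorem northSouthOn_lower {g : LampGroup} (hg : 0 < g.height) {ω : Set ℤ} (hω : BddBelow ω)
    (hf : move (reflect g) ω = ω) :
    NorthSouthOn g (busemannMinus ∪ {-heightFun}) (-heightFun) (LampGroup.pull (busemann ω)) := by
  have := (northSouthOn_upper_of_neg (by rw [reflect_height]; omega) hω hf).pull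
  rwa [reflect_reflect, pull_image_upper_union, pull_heightFun] at this

theorem northSouthOn_lower_of_neg {g : LampGroup} (hg : g.height < 0) {ω : Set ℤ}
    (hω : BddBelow ω) (hf : move (reflect g) ω = ω) :
    NorthSouthOn g (busemannMinus ∪ {-heightFun}) (LampGroup.pull (busemann ω)) (-heightFun) := by
  have := (northSouthOn_upper (by rw [reflect_height]; omega) hω hf).pull
  rwa [reflect_reflect, pull_image_upper_union, pull_heightFun] at this

end LampGroup

open LampGroup
theorem corollary7p2 :
    -- every family in the classification is invariant under the action of the group
    (∀ g : LampGroup, act g '' Set.range horoEmb = Set.range horoEmb) ∧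
    (∀ F ∈ boundaryFamilies, F ⊆ horoBoundary ∧ ∀ g : LampGroup, act g '' F = F) ∧
    -- fixed points and dynamics of an element of non-zero height
    (∀ g : LampGroup, g.height ≠ 0 →
      -- `p` and `q` are the two fixed points on the visual boundary
      ∃ p q : VisualBoundary, ∃ bp bq : LampGroup → ℝ,
        {ξ : VisualBoundary | visualAct g ξ = ξ} = {p, q} ∧
        (0 < g.height → p ∈ visualPlus ∧ q ∈ visualMinus) ∧
        (g.height < 0 → p ∈ visualMinus ∧ q ∈ visualPlus) ∧
        IsBusemann p bp ∧ IsBusemann q bq ∧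
        {h ∈ horoBoundary | act g h = h} = {heightFun, -heightFun, bp, bq} ∧
        ({heightFun, -heightFun, bp, bq} : Set (LampGroup → ℝ)).ncard = 4 ∧
        (0 < g.height →
          NorthSouthOn g (busemannPlus ∪ {heightFun}) bp heightFun ∧
          NorthSouthOn g (busemannMinus ∪ {-heightFun}) (-heightFun) bq) ∧
        (g.height < 0 →
          NorthSouthOn g (busemannMinus ∪ {-heightFun}) bp (-heightFun) ∧
          NorthSouthOn g (busemannPlus ∪ {heightFun}) heightFun bq)) := by
  refine ⟨act_image_eq range_subset_horoCompactification ?_, fun F hF => ?_, fun g hg => ?_⟩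
  · rintro g _ ⟨z, rfl⟩
    exact ⟨_, (act_horoEmb g z).symm⟩
  · have h := isInvariantFamily_of_mem hF
    exact ⟨h.1, act_image_eq (fun k hk => (h.1 hk).1) h.2⟩
  · obtain ⟨ω, hω, hf, hu⟩ := exists_unique_fixed hg
    -- The lower fixed point of `g` is the mirror image of the upper fixed point of `reflect g`.
    obtain ⟨ω', hω', hf', hu'⟩ := exists_unique_fixed (g := reflect g) (by simpa using hg)
    have hV := setOf_visual_fixed_eq hω hω' hf hu hf' hu'
    have hH := setOf_fixed_eq hg hω hω' hf hu hf' hu'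
    have hcard := ncard_fixed hω hω'
    have hP := upperPoint_mem_visualPlus hω
    have hQ := visualReflect_mem_visualMinus.2 (upperPoint_mem_visualPlus hω')
    have hbP := isBusemann_upperPoint hω
    have hbQ := (isBusemann_upperPoint hω').reflect
    rcases hg.lt_or_gt with hneg | hpos
    -- For negative height the attracting point is the lower one, so the two roles are exchanged.
    · refine ⟨_, _, _, _, hV.trans (Set.pair_comm _ _), fun h => absurd h hneg.not_gt,
        fun _ => ⟨hQ, hP⟩, hbQ, hbP, ?_, ?_, fun h => absurd h hneg.not_gt, fun _ => ⟨?_, ?_⟩⟩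
      · rw [hH, Set.pair_comm (busemann ω)]
      · rw [Set.pair_comm, hcard]
      · exact northSouthOn_lower_of_neg hneg hω' hf'
      · rw [busemannPlus_eq]
        exact northSouthOn_upper_of_neg hneg hω hf
    · refine ⟨_, _, _, _, hV, fun _ => ⟨hP, hQ⟩, fun h => absurd h hpos.not_gt, hbP, hbQ, hH, hcard,
        fun _ => ⟨?_, ?_⟩, fun h => absurd h hpos.not_gt⟩
      · rw [busemannPlus_eq]
        exact northSouthOn_upper hpos hω hf
      · exact northSouthOn_lower hpos hω' hf'
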